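/- **Setting.** Let $f:\mathbb R^m\times\mathbb R^n\to\mathbb R$ be twice continuously differentiable, convex in $x$ for every $y$ and concave in $y$ for every $x$, and let its Hessian be Lipschitz: there is $\rho>0$ with $\|\nabla^2 f(z)-\nabla^2 f(z')\|\le\rho\|z-z'\|$ for all $z=(x,y)$, $z'$ (spectral and Euclidean norms). Let $z^*=(x^*,y^*)$ be an optimal solution of $\min_x\max_y f(x,y)$, i.e. a saddle point: $f(x^*,y)\le f(x^*,y^*)\le f(x,y^*)$ for all $x,y$. For an objective $g$ write $F_g=(\nabla_x g,-\nabla_y g)$ and $DF_g$ for its Jacobian; $F=F_f$. **Line search** for $g$ at $\hat z$ from $H_{\rm init}$: for $j=0,1,2,\dots$ let $w_j$ solve $F_g(\hat z)+DF_g(\hat z)(w-\hat z)+6\cdot 2^jH_{\rm init}\|w-\hat z\|(w-\hat z)=0$; return $(2^jH_{\rm init},w_j)$ for the first $j$ with $\|F_g(w_j)-F_g(\hat z)-DF_g(\hat z)(w_j-\hat z)\|\le\frac{2^jH_{\rm init}}2\|w_j-\hat z\|^2$. **LF-CR** for $g$ from $(z_0,H_0)$ within $N$ iterations: set $\hat z_1=z_0$;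 for $k=1,2,\dots,N$ let $(H_k,z_{k+1})$ be returned by the line search at $\hat z_k$ from $H_{k-1}$, and set $\lambda_{k+1}=\frac{c_k}{H_k\|z_{k+1}-\hat z_k\|}$ with constants $c_k\in[\frac1{33},\frac1{13}]$, $\hat z_{k+1}=\hat z_k-\lambda_{k+1}F_g(z_{k+1})$. The output is $\big(\sum_{k=1}^N\lambda_{k+1}z_{k+1}/\sum_{k=1}^N\lambda_{k+1},\,H_N\big)$; if some $z_{s+1}=\hat z_s$ occurs (then $F_g(\hat z_s)=0$), the method stops at the first such $s$ and outputs $(z_{s+1},H_s)$. **FF-CR** with inputs $z_0$, $M_0>0$, $D_0>0$, $\varepsilon>0$. In round $t=0,1,2,\dots$ set $\bar z_0^t=z_0^t=z_0$, $\sigma_0^t=0$, $H_0^t=M_0^t=M_0$, and for $k=1,2,\dots$: * $\sigma_k^t=\frac{\varepsilon}{41D_t}4^k$, $\gamma_k^t=1-\sigma_{k-1}^t/\sigma_k^t$, $\bar z_k^t=(1-\gamma_k^t)\bar z_{k-1}^t+\gamma_k^tz_{k-1}^t$, and $f_k^t(x,y)=f(x,y)+\frac{\sigma_k^t}2\|x-\bar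 x_k^t\|^2-\frac{\sigma_k^t}2\|y-\bar y_k^t\|^2$; * $(z_k^t,H_k^t)$ is the output of LF-CR for $f_k^t$ from $(z_{k-1}^t,H_{k-1}^t)$ within $N_k^t=\big\lceil\big(33\sqrt3\,8^{3-k}H_k^tD_t/\sigma_k^t\big)^{2/3}\big\rceil$ iterations; * $(M_k^t,\tilde z_k^t)$ is returned by the line search for $f_k^t$ at $z_k^t$ from $\max\{M_{k-1}^t,\|DF(z_k^t)-DF(z_0)\|/\|z_k^t-z_0\|\}$ (the quotient being $0$ if $z_k^t=z_0$); * the round is left at the first $k\ge1$ with $k\ge\kappa(D_t,M_k^t)$, where $$\kappa(D,M)=\Big\lceil\max\Big\{\log_{64}\tfrac{32MD^2}{\varepsilon},\ \log_8\tfrac{8MD^2}{\varepsilon},\ \log_8\tfrac{4\sqrt{12/11}\,\|DF(z_0)\|D}{\varepsilon}\Big\}\Big\rceil$$ (a logarithm of $0$ being read as $0$); let $K_t$ be this $k$, and $z_{t+1}=z^t_{K_t}$. If $\|\nabla f(z_{t+1})\|\le\varepsilon$ the method stops; otherwise $D_{t+1}=4D_t$ and round $t+1$ starts. None of these choices uses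 $\rho$ or $z^*$. **Theorem 3.1.** For every sequence generated by FF-CR the method stops; let $T(\varepsilon)=\min\{t\ge0:\|\nabla f(z_{t+1})\|\le\varepsilon\}$ be the index of its last round. Then 1. $D_t\le\max\{D_0,\,4\|z_0-z^*\|\}$ for all $t\le T(\varepsilon)$; 2. $T(\varepsilon)\le\max\big\{0,\big\lceil\log_4\frac{\|z_0-z^*\|}{D_0}\big\rceil\big\}$ (the maximum being $0$ if $z_0=z^*$); 3. if $t\le T(\varepsilon)$ and $D_t\ge\|z_0-z^*\|$, then $\|\nabla f(z_{t+1})\|\le\varepsilon$; 4. with $L=\max\{M_0,2\rho\}$ and $\Delta=\max\{D_0,4\|z_0-z^*\|\}$, the total LF-CR iteration count satisfies $$\sum_{t=0}^{T(\varepsilon)}\sum_{k=1}^{K_t}N_k^t\ \le\ (T(\varepsilon)+1)\Big(\max\{1,\kappa(\Delta,L)\}+\tfrac{64}7\Big(\frac{1353\sqrt3\,L\Delta^2}{\varepsilon}\Big)^{2/3}\Big).$$ In particular, if $D_0<4\|z_0-z^*\|$, then $D_t\le4\|z_0-z^*\|$ for all $t\le T(\varepsilon)$ and $T(\varepsilon)\le\lceil\log_4(\|z_0-z^*\|/D_0)\rceil$;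 if also $M_0\le2\rho$, the last term in 4 is $\frac{64}7\big(43296\sqrt3\,\rho\|z_0-z^*\|^2/\varepsilon\big)^{2/3}$, so up to logarithmic factors the total count is $O\big((\rho\|z_0-z^*\|^2/\varepsilon)^{2/3}\big)$. -/

import Mathlib

noncomputable section

/-- The space `ℝᵐ × ℝⁿ` of points `z = (x, y)`, with the Euclidean norm. -/
abbrev Pt (m n : ℕ) : Type :=
  WithLp 2 (EuclideanSpace ℝ (Fin m) × EuclideanSpace ℝ (Fin n))

/-- The objectives `f(x, y)` of the problem `min_x max_y f(x, y)`. -/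
abbrev Obj (m n : ℕ) : Type :=
  EuclideanSpace ℝ (Fin m) → EuclideanSpace ℝ (Fin n) → ℝ

variable {m n : ℕ}

/-- `f` as a function of the single variable `z = (x, y)`. -/
def joint (f : Obj m n) (z : Pt m n) : ℝ := f z.fst z.snd

/-- The full gradient `∇f(z)`. -/
def fullGrad (f : Obj m n) (z : Pt m n) : Pt m n := gradient (joint f) z

/-- The full Hessian `∇²f(z)`, the derivative of the full gradient; its norm is the operator
(spectral) norm. -/
def fullHess (f : Obj m n) (z : Pt m n) : Pt m n →L[ℝ] Pt m n := fderiv ℝ (fullGrad f) z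

/-- The operator `F(z) = (∇ₓ f(x, y), -∇_y f(x, y))`. -/
def saddleOp (f : Obj m n) (z : Pt m n) : Pt m n :=
  WithLp.toLp 2 (gradient (fun x => f x z.snd) z.fst, -gradient (fun y => f z.fst y) z.snd)

/-- The Jacobian `DF(z)`. -/
def saddleJac (f : Obj m n) (z : Pt m n) : Pt m n →L[ℝ] Pt m n := fderiv ℝ (saddleOp f) z

/-- `z* = (x*, y*)` is an optimal solution (a saddle point) of `min_x max_y f(x, y)`. -/
def IsSaddle (f : Obj m n) (zs : Pt m n) : Prop :=
  ∀ x y, f zs.fst y ≤ f zs.fst zs.snd ∧ f zs.fst zs.snd ≤ f x zs.snd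

/-- `z` solves `F(ẑ) + DF(ẑ)(z - ẑ) + 6 H ‖z - ẑ‖ (z - ẑ) = 0`. -/
def CubicEq (f : Obj m n) (zhat : Pt m n) (H : ℝ) (z : Pt m n) : Prop :=
  saddleOp f zhat + saddleJac f zhat (z - zhat) + (6 * H * ‖z - zhat‖) • (z - zhat) = 0

/-- The acceptance test of the line search:
`‖F(z) - F(ẑ) - DF(ẑ)(z - ẑ)‖ ≤ (H / 2) ‖z - ẑ‖²`. -/
def Accept (f : Obj m n) (zhat : Pt m n) (H : ℝ) (z : Pt m n) : Prop :=
  ‖saddleOp f z - saddleOp f zhat - saddleJac f zhat (z - zhat)‖ ≤ H / 2 * ‖z - zhat‖ ^ 2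

/-- Backtracking line search at `ẑ` started from `Hinit`: the trial values are
`Hinit, 2 Hinit, 4 Hinit, …`, the trial point `w j` solves the cubic equation for the `j`-th
value, and the first accepted pair `(H, z)` is returned. -/
def LineSearch (f : Obj m n) (zhat : Pt m n) (Hinit H : ℝ) (z : Pt m n) : Prop :=
  ∃ (i : ℕ) (w : ℕ → Pt m n),
    (∀ j ≤ i, CubicEq f zhat (2 ^ j * Hinit) (w j)) ∧
    (∀ j < i, ¬ Accept f zhat (2 ^ j * Hinit) (w j)) ∧
    Accept f zhat (2 ^ i * Hinit) (w i) ∧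
    H = 2 ^ i * Hinit ∧ z = w i

/-- The stepsize `λ_{k+1} = c_k / (H_k ‖z_{k+1} - ẑ_k‖)`. -/
def stepsize (c H : ℕ → ℝ) (zhat z : ℕ → Pt m n) (k : ℕ) : ℝ :=
  c k / (H k * ‖z (k + 1) - zhat k‖)

/-- `ẑ_1, …, ẑ_s`, `z_2, …, z_{s+1}`, `H_0, …, H_s` are produced by the first `s` iterations of
the Lipschitz-free cubic regularization method from the point `z0` and the estimate `H0`.
None of the first `s - 1` iterations returned `z_{k+1} = ẑ_k`; so all stepsizes used are
well defined. -/
structure IsLFCR (f : Obj m n) (z0 : Pt m n) (H0 : ℝ) (s : ℕ)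
    (c H : ℕ → ℝ) (zhat z : ℕ → Pt m n) : Prop where
  const_mem : ∀ k, 1 ≤ k → k ≤ s → 1 / 33 ≤ c k ∧ c k ≤ 1 / 13
  init_point : zhat 1 = z0
  init_est : H 0 = H0
  search : ∀ k, 1 ≤ k → k ≤ s → LineSearch f (zhat k) (H (k - 1)) (H k) (z (k + 1))
  moved : ∀ k, 1 ≤ k → k < s → z (k + 1) ≠ zhat k
  extragrad : ∀ k, 1 ≤ k → k < s →
    zhat (k + 1) = zhat k - stepsize c H zhat z k • saddleOp f (z (k + 1))

/-- `(zout, Hout)` is the output of the Lipschitz-free cubic regularization method, run within `N`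
iterations from the point `z0` and the estimate `H0`. Normally exactly `N` iterations are made
and `zout` is the average of `z_2, …, z_{N+1}` with weights `λ_2, …, λ_{N+1}`. If an iteration
`s ≤ N` returns `z_{s+1} = ẑ_s`, which happens exactly when `F(ẑ_s) = 0` and leaves `λ_{s+1}`
undefined, then the method has found an exact solution and returns it. -/
def LFCROutput (f : Obj m n) (z0 : Pt m n) (H0 : ℝ) (N : ℕ) (zout : Pt m n) (Hout : ℝ) : Prop :=
  ∃ (s : ℕ) (c H : ℕ → ℝ) (zhat z : ℕ → Pt m n),
    1 ≤ s ∧ s ≤ N ∧ IsLFCR f z0 H0 s c H zhat z ∧ Hout = H s ∧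
    ((s = N ∧ z (s + 1) ≠ zhat s ∧
        zout = (∑ k ∈ Finset.Icc 1 s, stepsize c H zhat z k)⁻¹ •
          ∑ k ∈ Finset.Icc 1 s, stepsize c H zhat z k • z (k + 1)) ∨
      (z (s + 1) = zhat s ∧ zout = z (s + 1)))

/-- The regularized objective
`f(x, y) + (σ / 2) ‖x - x̄‖² - (σ / 2) ‖y - ȳ‖²`. -/
def regObj (f : Obj m n) (σ : ℝ) (zbar : Pt m n) : Obj m n := fun x y =>
  f x y + σ / 2 * ‖x - zbar.fst‖ ^ 2 - σ / 2 * ‖y - zbar.snd‖ ^ 2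

/-- The regularization parameters `σ_0 = 0` and `σ_k = ε 4ᵏ / (41 D)` for `k ≥ 1`. -/
def sigmaReg (ε D : ℝ) (k : ℕ) : ℝ := if k = 0 then 0 else ε / (41 * D) * 4 ^ k

/-- The weight `γ_k = 1 - σ_{k-1} / σ_k` (used for `k ≥ 1`). -/
def gammaReg (ε D : ℝ) (k : ℕ) : ℝ := 1 - sigmaReg ε D (k - 1) / sigmaReg ε D k

/-- The inner iteration count `⌈(33 √3 8^{3-k} H D / σ_k)^{2/3}⌉`. -/
def innerCount (ε D : ℝ) (k : ℕ) (H : ℝ) : ℕ :=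
  ⌈(33 * √3 * (8 : ℝ) ^ (3 - (k : ℤ)) * H * D / sigmaReg ε D k) ^ (2 / 3 : ℝ)⌉₊

/-- The number
`⌈max {log₆₄ (32 M D² / ε), log₈ (8 M D² / ε), log₈ (4 √(12/11) J D / ε)}⌉`,
where `J` stands for `‖DF(z_0)‖`. For `J = 0` the last logarithm is read as `0`; this is immaterial
because the result is only compared with integers `k ≥ 1`. -/
def outerCount (ε D J M : ℝ) : ℤ :=
  ⌈max (Real.logb 64 (32 * M * D ^ 2 / ε))
    (max (Real.logb 8 (8 * M * D ^ 2 / ε)) (Real.logb 8 (4 * √(12 / 11) * J * D / ε)))⌉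

/-- One round of the fully parameter-free method, for the guess `D`: `K` is the number of inner
iterations made, and `z_k`, `z̄_k`, `z̃_k`, `H_k`, `M_k`, `N_k` are the quantities of the `k`-th inner
iteration. The round is left at the first `k ≥ 1` with `k ≥ outerCount`, computed from the current
`M_k`. For `z_k = z_0` the quotient in `search` is read as `0`. -/
structure IsFFCRRound (f : Obj m n) (ε : ℝ) (z0 : Pt m n) (M0 D : ℝ) (K : ℕ)
    (z zbar ztil : ℕ → Pt m n) (H M : ℕ → ℝ) (N : ℕ → ℕ) : Prop where
  init_z : z 0 = z0
  init_zbar : zbar 0 = z0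
  init_H : H 0 = M0
  init_M : M 0 = M0
  one_le : 1 ≤ K
  average : ∀ k, 1 ≤ k → k ≤ K →
    zbar k = (1 - gammaReg ε D k) • zbar (k - 1) + gammaReg ε D k • z (k - 1)
  count : ∀ k, 1 ≤ k → k ≤ K → N k = innerCount ε D k (H k)
  solve : ∀ k, 1 ≤ k → k ≤ K →
    LFCROutput (regObj f (sigmaReg ε D k) (zbar k)) (z (k - 1)) (H (k - 1)) (N k) (z k) (H k)
  search : ∀ k, 1 ≤ k → k ≤ K →
    LineSearch (regObj f (sigmaReg ε D k) (zbar k)) (z k)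
      (max (M (k - 1)) (‖saddleJac f (z k) - saddleJac f z0‖ / ‖z k - z0‖)) (M k) (ztil k)
  go_on : ∀ k, 1 ≤ k → k < K → (k : ℤ) < outerCount ε D ‖saddleJac f z0‖ (M k)
  leave : outerCount ε D ‖saddleJac f z0‖ (M K) ≤ (K : ℤ)

/-- All quantities produced by the fully parameter-free method: the guesses `D_t`, the points `z_t`
(field `pt`), the number `K_t` of inner iterations made in round `t`, and `z_k^t`, `z̄_k^t`, `z̃_k^t`,
`H_k^t`, `M_k^t`, `N_k^t` (first argument `t`, second argument `k`). -/
structure FFCRData (m n : ℕ) where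
  D : ℕ → ℝ
  pt : ℕ → Pt m n
  K : ℕ → ℕ
  z : ℕ → ℕ → Pt m n
  zbar : ℕ → ℕ → Pt m n
  ztil : ℕ → ℕ → Pt m n
  H : ℕ → ℕ → ℝ
  M : ℕ → ℕ → ℝ
  N : ℕ → ℕ → ℕ

/-- Round `t` is reached: no earlier round `s` ended with `‖∇f(z_{s+1})‖ ≤ ε`. -/
def FFCRData.Reached (A : FFCRData m n) (f : Obj m n) (ε : ℝ) (t : ℕ) : Prop :=
  ∀ s < t, ε < ‖fullGrad f (A.pt (s + 1))‖

/-- `A` is generated by the fully parameter-free cubic regularization method with accuracy `ε` and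
inputs `z0`, `M0`, `D0`. The method stops after the first round `t` with `‖∇f(z_{t+1})‖ ≤ ε`; the
entries of `A` that belong to later rounds are arbitrary. -/
structure IsFFCR (f : Obj m n) (ε : ℝ) (z0 : Pt m n) (M0 D0 : ℝ) (A : FFCRData m n) : Prop where
  init_D : A.D 0 = D0
  init_pt : A.pt 0 = z0
  round : ∀ t, A.Reached f ε t →
    IsFFCRRound f ε z0 M0 (A.D t) (A.K t) (A.z t) (A.zbar t) (A.ztil t) (A.H t) (A.M t) (A.N t)
  output : ∀ t, A.Reached f ε t → A.pt (t + 1) = A.z t (A.K t)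
  next_D : ∀ t, A.Reached f ε (t + 1) → A.D (t + 1) = 4 * A.D t

end

/-! The core is a single round whose guess satisfies D ≥ ‖z₀ - z*‖. Write G_k = F + σ_k(· - z̄_k)
for the regularized operators and u_k for their zeros, with u_0 = z*. The weights γ_k are chosen so
that G_{k+1} = G_k + (σ_{k+1} - σ_k)(· - z_k): passing to the next problem adds a proximal term at
the current iterate. By monotonicity, z_k is then no farther from u_{k+1} than from u_k. LF-CR on a
σ-strongly monotone operator satisfies σ‖out - u‖² N^{3/2} ≤ 33 H ‖start - u‖³
(`LFCROutput.estimates`), and N_k is calibrated so that this divides the error by 8. Hence ‖z_k -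
u_k‖ ≤ D/8^k (`IsFFCRRound.exists_zeros`).

To bound F(z_K), subtract the accumulated proximal terms from G_K(z_K). The increments of σ grow
like 4^j while ‖z_K - z_j‖ decays like 8^{-j}, so these terms sum to a fixed fraction of ε. For
G_K(z_K), use the cubic step from z_K: its length is at most a constant times D/8^K, and the cubic
equation expresses G_K(z_K) through that step. Since M_K dominates the difference quotient of DF
between z₀ and z_K, the norm of DF(z_K) is controlled by ‖DF(z₀)‖, M_K and D, without ρ. The exit
test makes every resulting term small (`IsFFCRRound.norm_saddleOp_le`).

So every round with D_t ≥ ‖z₀ - z*‖ succeeds, and quadrupling the guess bounds both T and D_t. A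
rejected trial value is at most ρ, so all estimates stay below max{M₀, 2ρ}; the counts in a round
are then dominated by K plus a geometric series. -/

open Filter Topology

/-! ### Monotone operators: Taylor estimate, existence of zeros, one cubic step. -/

section Operators

variable {E : Type*} [NormedAddCommGroup E] [InnerProductSpace ℝ E]

/-- Taylor's estimate for a map whose derivative is Lipschitz. -/
theorem norm_taylor_le_of_lipschitz_deriv {G : E → E} {G' : E → E →L[ℝ] E} {ρ : ℝ}
    (hG : ∀ z, HasFDerivAt G (G' z) z) (hρ : ∀ z w, ‖G' z - G' w‖ ≤ ρ * ‖z - w‖) (z w : E) :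
    ‖G w - G z - G' z (w - z)‖ ≤ ρ / 2 * ‖w - z‖ ^ 2 := by
  set v := w - z with hv
  have hderiv : ∀ t : ℝ, HasDerivAt (fun t : ℝ => G (z + t • v) - G z - t • G' z v)
      (G' (z + t • v) v - G' z v) t := by
    intro t
    have h1 : HasDerivAt (fun t : ℝ => z + t • v) v t := by
      simpa using ((hasDerivAt_id t).smul_const v).const_add z
    have h2 := (hG (z + t • v)).comp_hasDerivAt t h1
    have h3 : HasDerivAt (fun t : ℝ => t • G' z v) (G' z v) t := by
      simpa using (hasDerivAt_id t).smul_const (G' z v)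
    exact (h2.sub_const (G z)).sub h3
  -- Comparison function on the segment: its derivative dominates the norm of the remainder's
  -- derivative, which is at most ρ t ‖v‖².
  have hB : ∀ t : ℝ, HasDerivAt (fun t : ℝ => ρ / 2 * ‖v‖ ^ 2 * t ^ 2)
      (ρ * ‖v‖ ^ 2 * t) t := by
    intro t
    refine ((hasDerivAt_pow 2 t).const_mul (ρ / 2 * ‖v‖ ^ 2)).congr_deriv ?_
    push_cast
    ring
  have key := image_norm_le_of_norm_deriv_right_le_deriv_boundary
    (f := fun t : ℝ => G (z + t • v) - G z - t • G' z v)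
    (f' := fun t => G' (z + t • v) v - G' z v) (a := 0) (b := 1)
    (B := fun t => ρ / 2 * ‖v‖ ^ 2 * t ^ 2) (B' := fun t => ρ * ‖v‖ ^ 2 * t)
    (fun t _ => (hderiv t).continuousAt.continuousWithinAt)
    (fun t _ => (hderiv t).hasDerivWithinAt) (by simp) hB
    (fun t ht => by
      have h1 := (G' (z + t • v) - G' z).le_opNorm v
      have h2 := hρ (z + t • v) z
      rw [add_sub_cancel_left, norm_smul, Real.norm_eq_abs, abs_of_nonneg ht.1] at h2
      have h3 := mul_le_mul_of_nonneg_right h2 (norm_nonneg v)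
      rw [sub_apply] at h1
      linarith)
    (Set.right_mem_Icc.2 zero_le_one)
  simpa [hv] using key

/-- A continuously differentiable strongly monotone operator on a finite-dimensional space has a
zero. -/
theorem exists_zero_of_strongly_monotone [FiniteDimensional ℝ E] {G : E → E}
    (hG : ContDiff ℝ 1 G) {σ : ℝ} (hσ : 0 < σ)
    (hmono : ∀ z w, σ * ‖z - w‖ ^ 2 ≤ inner ℝ (G z - G w) (z - w)) : ∃ u, G u = 0 := by
  have hexp : ∀ z w, σ * ‖z - w‖ ≤ ‖G z - G w‖ := by
    intro z w
    rcases eq_or_ne z w with rfl | h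
    · simp
    · have h1 := (hmono z w).trans (real_inner_le_norm _ _)
      have h2 : 0 < ‖z - w‖ := norm_pos_iff.2 (sub_ne_zero.2 h)
      nlinarith
  have hanti : AntilipschitzWith (Real.toNNReal σ⁻¹) G := by
    refine AntilipschitzWith.of_le_mul_dist fun z w => ?_
    rw [Real.coe_toNNReal _ (inv_pos.2 hσ).le, dist_eq_norm, dist_eq_norm, inv_mul_eq_div,
      le_div_iff₀ hσ, mul_comm]
    exact hexp z w
  -- The range is closed because an expanding map is proper, and open by the inverse function
  -- theorem; connectedness then makes it everything.
  have hclosed : IsClosed (Set.range G) := by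
    have : ProperSpace E := FiniteDimensional.proper ℝ E
    have hproper : IsProperMap G := by
      rw [isProperMap_iff_tendsto_cocompact]
      refine ⟨hG.continuous, ?_⟩
      rw [← Metric.cobounded_eq_cocompact]
      exact hanti.tendsto_cobounded
    exact hproper.isClosedMap.isClosed_range
  have hopen : IsOpen (Set.range G) := by
    have : CompleteSpace E := FiniteDimensional.complete ℝ E
    rw [isOpen_iff_mem_nhds]
    rintro _ ⟨z, rfl⟩
    have hs : HasStrictFDerivAt G (fderiv ℝ G z) z := hG.contDiffAt.hasStrictFDerivAt one_ne_zero
    have hinj : Function.Injective (fderiv ℝ G z) := by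
      rw [injective_iff_map_eq_zero]
      intro v hv
      have h1 : HasDerivAt (fun t : ℝ => z + t • v) v 0 := by
        simpa using ((hasDerivAt_id (0 : ℝ)).smul_const v).const_add z
      have h2 : HasDerivAt (fun t : ℝ => G (z + t • v)) (fderiv ℝ G z v) 0 := by
        have h0 : HasFDerivAt G (fderiv ℝ G z) (z + (0 : ℝ) • v) := by
          simpa using hs.hasFDerivAt
        exact h0.comp_hasDerivAt 0 h1
      rw [hasDerivAt_iff_tendsto_slope] at h2
      have h3 := h2.norm
      -- The expansion bound passes to the derivative as a limit of difference quotients.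
      have h4 : σ * ‖v‖ ≤ ‖fderiv ℝ G z v‖ := by
        refine ge_of_tendsto h3 ?_
        filter_upwards [self_mem_nhdsWithin] with t ht
        have h5 := hexp (z + t • v) z
        rw [add_sub_cancel_left, norm_smul] at h5
        rw [slope_def_module, norm_smul, norm_inv]
        simp only [sub_zero, zero_smul, add_zero]
        have h6 : 0 < ‖t‖ := norm_pos_iff.2 ht
        rw [inv_mul_eq_div, le_div_iff₀ h6]
        linarith
      rw [hv, norm_zero] at h4
      have h7 : ‖v‖ ≤ 0 := by
        by_contra h
        have := mul_pos hσ (not_le.1 h)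
        linarith
      exact norm_le_zero_iff.1 h7
    have hsurj : Function.Surjective (fderiv ℝ G z) :=
      LinearMap.surjective_of_injective (f := (fderiv ℝ G z : E →ₗ[ℝ] E)) hinj
    have := hs.map_nhds_eq_of_surj (LinearMap.range_eq_top.2 hsurj)
    rw [← this]
    exact Filter.mem_map.2 (Filter.univ_mem' fun x => Set.mem_range_self x)
  have huniv : Set.range G = Set.univ :=
    IsClopen.eq_univ ⟨hclosed, hopen⟩ ⟨G 0, Set.mem_range_self 0⟩
  exact Set.range_eq_univ.1 huniv 0

/-- One step of the extragradient scheme with an implicit cubic step. -/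
theorem extragradient_step_le {g ζ z u : E} {H c : ℝ} (hH : 0 < H) (hne : z ≠ ζ)
    (hc : 1 / 33 ≤ c) (hc' : c ≤ 1 / 13)
    (hg : ‖g + (6 * H * ‖z - ζ‖) • (z - ζ)‖ ≤ H / 2 * ‖z - ζ‖ ^ 2) :
    2 * (c / (H * ‖z - ζ‖)) * inner ℝ g (z - u) + 11 / 36 * ‖z - ζ‖ ^ 2 ≤
      ‖ζ - u‖ ^ 2 - ‖ζ - (c / (H * ‖z - ζ‖)) • g - u‖ ^ 2 := by
  set r := ‖z - ζ‖ with hr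
  have hrpos : 0 < r := norm_pos_iff.2 (sub_ne_zero.2 hne)
  set l := c / (H * r) with hl
  have hlpos : 0 < l := by positivity
  have hlH : l * (H * r) = c := by rw [hl]; field_simp
  -- The extragradient point ζ - l g is close to z: the two parts contribute 1 - 6c and c/2, and 1 -
  -- 11c/2 ≤ 5/6 for c ≥ 1/33. The gain in the conclusion is 1 - 25/36 = 11/36.
  have hdist : ‖z - ζ + l • g‖ ≤ 5 / 6 * r := by
    have h1 : z - ζ + l • g = (1 - 6 * c) • (z - ζ) + l • (g + (6 * H * r) • (z - ζ)) := by
      rw [← hlH]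
      module
    have h2 : ‖(1 - 6 * c) • (z - ζ)‖ = (1 - 6 * c) * r := by
      rw [norm_smul, Real.norm_eq_abs, abs_of_nonneg (by linarith)]
    have h3 : ‖l • (g + (6 * H * r) • (z - ζ))‖ ≤ c / 2 * r := by
      rw [norm_smul, Real.norm_eq_abs, abs_of_pos hlpos]
      calc l * _ ≤ l * (H / 2 * r ^ 2) := mul_le_mul_of_nonneg_left hg hlpos.le
        _ = l * (H * r) / 2 * r := by ring
        _ = c / 2 * r := by rw [hlH]
    rw [h1]
    refine (norm_add_le _ _).trans ?_
    rw [h2]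
    nlinarith
  have hsq : ‖z - ζ + l • g‖ ^ 2 ≤ 25 / 36 * r ^ 2 := by
    have := pow_le_pow_left₀ (norm_nonneg _) hdist 2
    linarith
  have hid : 2 * l * inner ℝ g (z - u) =
      ‖ζ - u‖ ^ 2 - ‖ζ - l • g - u‖ ^ 2 + ‖z - ζ + l • g‖ ^ 2 - r ^ 2 := by
    have h1 : ζ - l • g - u = (ζ - u) - l • g := by abel
    have h2 : z - u = (z - ζ) + (ζ - u) := by abel
    rw [h1, norm_sub_sq_real (ζ - u), norm_add_sq_real, h2, inner_add_right, real_inner_smul_right,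
      real_inner_smul_right, real_inner_comm g (ζ - u), real_inner_comm g (z - ζ), ← hr]
    ring
  linarith

/-- The implicit cubic step is not much longer than the distance to any zero. -/
theorem cubic_step_le {G : E → E} {ζ z u : E} {H : ℝ} (hH : 0 < H) (hu : G u = 0)
    (hmono : 0 ≤ inner ℝ (G z - G u) (z - u))
    (hg : ‖G z + (6 * H * ‖z - ζ‖) • (z - ζ)‖ ≤ H / 2 * ‖z - ζ‖ ^ 2) :
    ‖z - ζ‖ ≤ 101 / 100 * ‖ζ - u‖ := by
  set r := ‖z - ζ‖ with hr
  rcases (norm_nonneg (z - ζ)).eq_or_lt with h0 | hrpos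
  · rw [hr, ← h0]; positivity
  rw [← hr] at hrpos
  rw [hu, sub_zero] at hmono
  have h1 := (real_inner_le_norm (G z + (6 * H * r) • (z - ζ)) (z - u)).trans
    (mul_le_mul_of_nonneg_right hg (norm_nonneg _))
  rw [inner_add_left, real_inner_smul_left] at h1
  have h2 : 12 * inner ℝ (z - ζ) (z - u) ≤ r * ‖z - u‖ := by
    have h3 : H / 2 * r * (12 * inner ℝ (z - ζ) (z - u)) ≤ H / 2 * r * (r * ‖z - u‖) := by
      linarith
    exact le_of_mul_le_mul_left h3 (by positivity)
  have h4 : ‖ζ - u‖ ^ 2 = ‖z - u‖ ^ 2 - 2 * inner ℝ (z - ζ) (z - u) + r ^ 2 := by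
    have : ζ - u = (z - u) - (z - ζ) := by abel
    rw [this, norm_sub_sq_real, real_inner_comm]
  refine le_of_sq_le_sq ?_ (by positivity)
  -- Completing the square gives ‖ζ - u‖² ≥ (‖z - u‖ - r/12)² + (143/144) r², and 144/143 <
  -- (101/100)².
  nlinarith [sq_nonneg (12 * ‖z - u‖ - r)]

end Operators

/-- A lower bound for a sum of inverses in terms of the sum of squares. -/
theorem card_mul_sqrt_le_sum_inv {ι : Type*} (s : Finset ι) {r : ι → ℝ} (hr : ∀ k ∈ s, 0 < r k)
    {d : ℝ} (hd : 0 < d) (hsum : ∑ k ∈ s, r k ^ 2 ≤ 4 * d ^ 2) :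
    √(s.card : ℝ) ^ 3 ≤ 2 * d * ∑ k ∈ s, (r k)⁻¹ := by
  rcases s.eq_empty_or_nonempty with rfl | hs
  · simp
  have hN : 0 < (s.card : ℝ) := by exact_mod_cast hs.card_pos
  set q := √(s.card : ℝ) with hq
  have hqpos : 0 < q := Real.sqrt_pos.2 hN
  have hqsq : q ^ 2 = s.card := Real.sq_sqrt hN.le
  set τ := 2 * d / q with hτ
  have hτpos : 0 < τ := by positivity
  -- Here τ is the common value of the r k in the extremal case. After multiplication by r k the
  -- claim is (2τ + r)(τ - r)² ≥ 0.
  have hterm : ∀ k ∈ s, 3 * τ ^ 2 - r k ^ 2 ≤ 2 * τ ^ 3 * (r k)⁻¹ := by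
    intro k hk
    have hk := hr k hk
    rw [← div_eq_mul_inv, le_div_iff₀ hk]
    nlinarith [mul_nonneg (add_pos (mul_pos two_pos hτpos) hk).le (sq_nonneg (τ - r k))]
  have h1 := Finset.sum_le_sum hterm
  rw [Finset.sum_sub_distrib, Finset.sum_const, nsmul_eq_mul, ← Finset.mul_sum, ← hqsq] at h1
  have h2 : q * τ = 2 * d := by rw [hτ]; field_simp
  have h3 : 4 * d ^ 2 = q ^ 2 * τ ^ 2 := by rw [← mul_pow, h2]; ring
  have h4 : τ ^ 2 * q ^ 2 ≤ τ ^ 2 * (τ * ∑ k ∈ s, (r k)⁻¹) := by nlinarith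
  have h5 := le_of_mul_le_mul_left h4 (by positivity)
  calc q ^ 3 = q * q ^ 2 := by ring
    _ ≤ q * (τ * ∑ k ∈ s, (r k)⁻¹) := mul_le_mul_of_nonneg_left h5 hqpos.le
    _ = _ := by rw [← mul_assoc, h2]

/-! ### Gradients, Jacobians and monotonicity of the saddle operator. -/

section Saddle

variable {m n : ℕ}

/-- The reflection `(x, y) ↦ (x, -y)`. -/
noncomputable def reflectSnd (m n : ℕ) : Pt m n →L[ℝ] Pt m n :=
  ((WithLp.prodContinuousLinearEquiv 2 ℝ (EuclideanSpace ℝ (Fin m))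
      (EuclideanSpace ℝ (Fin n))).symm : _ →L[ℝ] Pt m n) ∘L
    ((WithLp.fstL 2 ℝ (EuclideanSpace ℝ (Fin m)) (EuclideanSpace ℝ (Fin n))).prod
      (-WithLp.sndL 2 ℝ (EuclideanSpace ℝ (Fin m)) (EuclideanSpace ℝ (Fin n))))

theorem reflectSnd_apply (z : Pt m n) : reflectSnd m n z = WithLp.toLp 2 (z.fst, -z.snd) := rfl

theorem norm_reflectSnd (z : Pt m n) : ‖reflectSnd m n z‖ = ‖z‖ := by
  rw [reflectSnd_apply, WithLp.prod_norm_eq_of_L2, WithLp.prod_norm_eq_of_L2]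
  simp

theorem norm_reflectSnd_comp_le (A : Pt m n →L[ℝ] Pt m n) : ‖reflectSnd m n ∘L A‖ ≤ ‖A‖ :=
  ContinuousLinearMap.opNorm_le_bound _ (norm_nonneg _) fun v => by
    rw [ContinuousLinearMap.comp_apply, norm_reflectSnd]
    exact A.le_opNorm v

/-- The identification of the product with the Euclidean product, as a continuous linear map. -/
noncomputable def pairCLM (m n : ℕ) :
    EuclideanSpace ℝ (Fin m) × EuclideanSpace ℝ (Fin n) →L[ℝ] Pt m n :=
  ((WithLp.prodContinuousLinearEquiv 2 ℝ (EuclideanSpace ℝ (Fin m))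
      (EuclideanSpace ℝ (Fin n))).symm : _ →L[ℝ] Pt m n)

theorem pairCLM_apply (p : EuclideanSpace ℝ (Fin m) × EuclideanSpace ℝ (Fin n)) :
    pairCLM m n p = WithLp.toLp 2 p := rfl

/-- `HasFDerivAt.fderiv` for self-maps of a normed space; unification through `Pt` is slow for the
general version. -/
theorem fderiv_eq_of_hasFDerivAt {E : Type*} [NormedAddCommGroup E] [NormedSpace ℝ E] {G : E → E}
    {G' : E →L[ℝ] E} {z : E} (h : HasFDerivAt G G' z) : fderiv ℝ G z = G' := h.fderiv

theorem hasGradientAt_joint {f : Obj m n} (hf : Differentiable ℝ (joint f)) (z : Pt m n) :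
    HasGradientAt (joint f) (fullGrad f z) z := (hf z).hasGradientAt

theorem hasGradientAt_fst {f : Obj m n} (hf : Differentiable ℝ (joint f)) (z : Pt m n) :
    HasGradientAt (fun x => f x z.snd) (fullGrad f z).fst z.fst := by
  have h1 := ((pairCLM m n).hasFDerivAt (x := (z.fst, z.snd))).comp z.fst
    (hasFDerivAt_prodMk_left (𝕜 := ℝ) z.fst z.snd)
  have h2 := HasFDerivAt.comp z.fst (g := joint f)
    (show HasFDerivAt (joint f) _ (pairCLM m n (z.fst, z.snd)) from
      (hasGradientAt_joint hf z).hasFDerivAt) h1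
  rw [hasGradientAt_iff_hasFDerivAt]
  refine h2.congr_fderiv ?_
  ext v
  simp [WithLp.prod_inner_apply, pairCLM_apply]

theorem hasGradientAt_snd {f : Obj m n} (hf : Differentiable ℝ (joint f)) (z : Pt m n) :
    HasGradientAt (fun y => f z.fst y) (fullGrad f z).snd z.snd := by
  have h1 := ((pairCLM m n).hasFDerivAt (x := (z.fst, z.snd))).comp z.snd
    (hasFDerivAt_prodMk_right (𝕜 := ℝ) z.fst z.snd)
  have h2 := HasFDerivAt.comp z.snd (g := joint f)
    (show HasFDerivAt (joint f) _ (pairCLM m n (z.fst, z.snd)) from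
      (hasGradientAt_joint hf z).hasFDerivAt) h1
  rw [hasGradientAt_iff_hasFDerivAt]
  refine h2.congr_fderiv ?_
  ext v
  simp [WithLp.prod_inner_apply, pairCLM_apply]

theorem saddleOp_eq_reflectSnd {f : Obj m n} (hf : Differentiable ℝ (joint f)) (z : Pt m n) :
    saddleOp f z = reflectSnd m n (fullGrad f z) := by
  rw [saddleOp, (hasGradientAt_fst hf z).gradient, (hasGradientAt_snd hf z).gradient,
    reflectSnd_apply]

theorem norm_fullGrad {f : Obj m n} (hf : Differentiable ℝ (joint f)) (z : Pt m n) :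
    ‖fullGrad f z‖ = ‖saddleOp f z‖ := by
  rw [saddleOp_eq_reflectSnd hf, norm_reflectSnd]

theorem contDiff_fullGrad {f : Obj m n} (hf : ContDiff ℝ 2 (joint f)) :
    ContDiff ℝ 1 (fullGrad f) := by
  have h : ContDiff ℝ 1 (fderiv ℝ (joint f)) := hf.fderiv_right (by norm_num)
  exact (InnerProductSpace.toDual ℝ (Pt m n)).symm.contDiff.comp h

theorem contDiff_saddleOp {f : Obj m n} (hf : ContDiff ℝ 2 (joint f)) :
    ContDiff ℝ 1 (saddleOp f) := by
  have h : saddleOp f = reflectSnd m n ∘ fullGrad f :=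
    funext (saddleOp_eq_reflectSnd (hf.differentiable two_ne_zero))
  rw [h]
  exact (reflectSnd m n).contDiff.comp (contDiff_fullGrad hf)

theorem hasFDerivAt_saddleOp {f : Obj m n} (hf : ContDiff ℝ 2 (joint f)) (z : Pt m n) :
    HasFDerivAt (saddleOp f) (saddleJac f z) z :=
  ((contDiff_saddleOp hf).differentiable one_ne_zero z).hasFDerivAt

theorem saddleJac_eq_reflectSnd {f : Obj m n} (hf : ContDiff ℝ 2 (joint f)) (z : Pt m n) :
    saddleJac f z = reflectSnd m n ∘L fullHess f z := by
  have h : saddleOp f = reflectSnd m n ∘ fullGrad f :=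
    funext (saddleOp_eq_reflectSnd (hf.differentiable two_ne_zero))
  have h1 : HasFDerivAt (fullGrad f) (fullHess f z) z :=
    ((contDiff_fullGrad hf).differentiable one_ne_zero z).hasFDerivAt
  have h2 : HasFDerivAt (saddleOp f) (reflectSnd m n ∘L fullHess f z) z := by
    rw [h]
    exact (reflectSnd m n).hasFDerivAt.comp z h1
  exact fderiv_eq_of_hasFDerivAt h2

/-- The reflection is a linear isometry, so the Lipschitz constant of the Hessian carries over to
the Jacobian. -/
theorem norm_saddleJac_sub_le {f : Obj m n} (hf : ContDiff ℝ 2 (joint f)) {ρ : ℝ}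
    (hLip : ∀ z z' : Pt m n, ‖fullHess f z - fullHess f z'‖ ≤ ρ * ‖z - z'‖) (z z' : Pt m n) :
    ‖saddleJac f z - saddleJac f z'‖ ≤ ρ * ‖z - z'‖ := by
  rw [saddleJac_eq_reflectSnd hf, saddleJac_eq_reflectSnd hf, ← ContinuousLinearMap.comp_sub]
  exact (norm_reflectSnd_comp_le _).trans (hLip z z')

/-- The gradient inequality for a convex function on the whole space. -/
theorem ConvexOn.inner_gradient_le {E : Type*} [NormedAddCommGroup E] [InnerProductSpace ℝ E]
    [CompleteSpace E] {φ : E → ℝ} (hφ : ConvexOn ℝ Set.univ φ) {g x : E}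
    (hg : HasGradientAt φ g x) (x' : E) : inner ℝ g (x' - x) ≤ φ x' - φ x := by
  have h1 : HasDerivAt (fun t : ℝ => x + t • (x' - x)) (x' - x) 0 := by
    simpa using ((hasDerivAt_id (0 : ℝ)).smul_const (x' - x)).const_add x
  have h2 : HasDerivAt (fun t : ℝ => φ (x + t • (x' - x))) (inner ℝ g (x' - x)) 0 := by
    have h0 : HasFDerivAt φ (InnerProductSpace.toDual ℝ E g) (x + (0 : ℝ) • (x' - x)) := by
      simpa using hg.hasFDerivAt
    exact h0.comp_hasDerivAt 0 h1
  have h3 : ConvexOn ℝ Set.univ (fun t : ℝ => φ (x + t • (x' - x))) := by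
    have := hφ.comp_affineMap (AffineMap.lineMap x x')
    simpa [Function.comp_def, AffineMap.lineMap_apply, add_comm] using this
  have h4 := h3.le_slope_of_hasDerivAt (Set.mem_univ 0) (Set.mem_univ 1) zero_lt_one h2
  simpa [slope_def_field] using h4

/-- Add the gradient inequalities of f(·, y) and of -f(x, ·) at both points; the function values,
including the mixed ones, cancel. -/
theorem saddleOp_monotone {f : Obj m n} (hf : Differentiable ℝ (joint f))
    (hconv : ∀ y, ConvexOn ℝ Set.univ (fun x => f x y))
    (hconc : ∀ x, ConcaveOn ℝ Set.univ (fun y => f x y)) (z w : Pt m n) :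
    0 ≤ inner ℝ (saddleOp f z - saddleOp f w) (z - w) := by
  have hneg : ∀ v : Pt m n,
      HasGradientAt (-fun y => f v.fst y) (-(fullGrad f v).snd) v.snd := by
    intro v
    have := (hasGradientAt_snd hf v).hasFDerivAt.neg
    rw [hasGradientAt_iff_hasFDerivAt, map_neg]
    exact this
  have h1 := (hconv z.snd).inner_gradient_le (hasGradientAt_fst hf z) w.fst
  have h2 := (hconv w.snd).inner_gradient_le (hasGradientAt_fst hf w) z.fst
  have h3 := (hconc z.fst).neg.inner_gradient_le (hneg z) w.snd
  have h4 := (hconc w.fst).neg.inner_gradient_le (hneg w) z.snd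
  rw [saddleOp_eq_reflectSnd hf, saddleOp_eq_reflectSnd hf, reflectSnd_apply, reflectSnd_apply,
    WithLp.prod_inner_apply]
  simp only [Pi.neg_apply, inner_neg_left, inner_sub_right] at h1 h2 h3 h4
  change 0 ≤ inner ℝ ((fullGrad f z).fst - (fullGrad f w).fst) (z.fst - w.fst) +
    inner ℝ (-(fullGrad f z).snd - -(fullGrad f w).snd) (z.snd - w.snd)
  simp only [inner_sub_left, inner_sub_right, inner_neg_left]
  linarith

theorem IsSaddle.saddleOp_eq_zero {f : Obj m n} (hf : Differentiable ℝ (joint f)) {zs : Pt m n}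
    (hzs : IsSaddle f zs) : saddleOp f zs = 0 := by
  have h1 : IsLocalMin (fun x => f x zs.snd) zs.fst :=
    Eventually.of_forall fun x => (hzs x zs.snd).2
  have h2 : IsLocalMax (fun y => f zs.fst y) zs.snd :=
    Eventually.of_forall fun y => (hzs zs.fst y).1
  have h3 := h1.hasFDerivAt_eq_zero (hasGradientAt_fst hf zs).hasFDerivAt
  have h4 := h2.hasFDerivAt_eq_zero (hasGradientAt_snd hf zs).hasFDerivAt
  rw [map_eq_zero_iff _ (InnerProductSpace.toDual ℝ _).injective] at h3 h4
  rw [saddleOp_eq_reflectSnd hf, reflectSnd_apply, h3, h4, neg_zero]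
  rfl

theorem saddleOp_regObj {f : Obj m n} (hf : Differentiable ℝ (joint f)) (σ : ℝ) (zbar z : Pt m n) :
    saddleOp (regObj f σ zbar) z = saddleOp f z + σ • (z - zbar) := by
  have hsq : ∀ {d : ℕ} (v c : EuclideanSpace ℝ (Fin d)),
      HasFDerivAt (fun x => σ / 2 * ‖x - c‖ ^ 2)
        (InnerProductSpace.toDual ℝ _ (σ • (v - c))) v := by
    intro d v c
    have := (((hasFDerivAt_id v).sub_const c).norm_sq).const_mul (σ / 2)
    refine this.congr_fderiv ?_
    ext w
    simp
    ring
  have hx : HasGradientAt (fun x => regObj f σ zbar x z.snd)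
      ((fullGrad f z).fst + σ • (z.fst - zbar.fst)) z.fst := by
    rw [hasGradientAt_iff_hasFDerivAt, map_add]
    exact ((hasGradientAt_fst hf z).hasFDerivAt.add (hsq z.fst zbar.fst)).sub_const _
  have hy : HasGradientAt (fun y => regObj f σ zbar z.fst y)
      ((fullGrad f z).snd - σ • (z.snd - zbar.snd)) z.snd := by
    rw [hasGradientAt_iff_hasFDerivAt, map_sub]
    exact ((hasGradientAt_snd hf z).hasFDerivAt.add_const _).sub (hsq z.snd zbar.snd)
  rw [saddleOp_eq_reflectSnd hf, saddleOp, hx.gradient, hy.gradient, reflectSnd_apply, neg_sub']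
  apply WithLp.ofLp_injective
  ext1 <;> simp

theorem saddleJac_regObj {f : Obj m n} (hf : ContDiff ℝ 2 (joint f)) (σ : ℝ) (zbar z : Pt m n) :
    saddleJac (regObj f σ zbar) z = saddleJac f z + σ • ContinuousLinearMap.id ℝ (Pt m n) := by
  have h : saddleOp (regObj f σ zbar) = fun z => saddleOp f z + σ • (z - zbar) :=
    funext (saddleOp_regObj (hf.differentiable two_ne_zero) σ zbar)
  have h2 : HasFDerivAt (saddleOp (regObj f σ zbar))
      (saddleJac f z + σ • ContinuousLinearMap.id ℝ (Pt m n)) z := by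
    rw [h]
    exact (hasFDerivAt_saddleOp hf z).add (((hasFDerivAt_id z).sub_const zbar).const_smul σ)
  exact fderiv_eq_of_hasFDerivAt h2

end Saddle

/-! ### The line search and the convergence rate of LF-CR. -/

section Methods

variable {m n : ℕ}

/-- By the Taylor estimate a trial value of at least ρ is accepted, so the last rejected one is
below ρ and its double is at most 2ρ. The cubic equation identifies the Taylor remainder in the
acceptance test with F(z) + 6H‖z - ζ‖(z - ζ), the quantity needed for the extragradient step. -/
theorem LineSearch.estimates {g : Obj m n} {ζ z : Pt m n} {Hinit H ρ : ℝ}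
    (hG : ∀ z, HasFDerivAt (saddleOp g) (saddleJac g z) z)
    (hLip : ∀ z w, ‖saddleJac g z - saddleJac g w‖ ≤ ρ * ‖z - w‖)
    (h : LineSearch g ζ Hinit H z) (hH : 0 < Hinit) :
    Hinit ≤ H ∧ H ≤ max Hinit (2 * ρ) ∧ CubicEq g ζ H z ∧
      ‖saddleOp g z + (6 * H * ‖z - ζ‖) • (z - ζ)‖ ≤ H / 2 * ‖z - ζ‖ ^ 2 := by
  obtain ⟨i, w, hcub, hrej, hacc, rfl, rfl⟩ := h
  refine ⟨le_mul_of_one_le_left hH.le (one_le_pow₀ one_le_two), ?_, hcub i le_rfl, ?_⟩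
  · cases i with
    | zero => simp
    | succ j =>
      have h1 : 2 ^ j * Hinit ≤ ρ := by
        by_contra hcon
        refine hrej j (Nat.lt_succ_self j)
          ((norm_taylor_le_of_lipschitz_deriv hG hLip ζ (w j)).trans ?_)
        gcongr
        exact (not_le.1 hcon).le
      refine le_max_of_le_right ?_
      rw [pow_succ]
      linarith
  · have h1 := hcub i le_rfl
    have h2 : saddleOp g (w i) + (6 * (2 ^ i * Hinit) * ‖w i - ζ‖) • (w i - ζ) =
        saddleOp g (w i) - saddleOp g ζ - saddleJac g ζ (w i - ζ) := by
      rw [CubicEq] at h1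
      rw [← sub_eq_zero, ← h1]
      abel
    rw [h2]
    exact hacc

/-- The monotonicity clause allows every stepsize to be bounded below in terms of the final
estimate. -/
theorem IsLFCR.estimate_bounds {g : Obj m n} {z0 : Pt m n} {H0 ρ : ℝ} {s : ℕ} {c H : ℕ → ℝ}
    {ζ z : ℕ → Pt m n}
    (hG : ∀ z, HasFDerivAt (saddleOp g) (saddleJac g z) z)
    (hLip : ∀ z w, ‖saddleJac g z - saddleJac g w‖ ≤ ρ * ‖z - w‖)
    (h : IsLFCR g z0 H0 s c H ζ z) (hH : 0 < H0) :
    ∀ k ≤ s, (H0 ≤ H k ∧ H k ≤ max H0 (2 * ρ)) ∧ ∀ j ≤ k, H j ≤ H k := by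
  intro k
  induction k with
  | zero =>
    intro _
    rw [h.init_est]
    refine ⟨⟨le_rfl, le_max_left _ _⟩, fun j hj => ?_⟩
    rw [Nat.le_zero.1 hj, h.init_est]
  | succ k ih =>
    intro hk
    obtain ⟨⟨h1, h2⟩, h3⟩ := ih (Nat.le_of_succ_le hk)
    obtain ⟨h4, h5, -⟩ := (h.search (k + 1) (Nat.le_add_left 1 k) hk).estimates hG hLip
      (by simpa using hH.trans_le h1)
    rw [Nat.add_sub_cancel] at h4 h5
    refine ⟨⟨h1.trans h4, h5.trans (max_le h2 (le_max_right _ _))⟩, fun j hj => ?_⟩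
    rcases Nat.le_succ_iff.1 hj with hj | rfl
    · exact (h3 j hj).trans h4
    · exact le_rfl

/-- The potential estimate behind the convergence rate of the extragradient iteration. -/
theorem IsLFCR.sum_le {g : Obj m n} {z0 u : Pt m n} {H0 ρ σ : ℝ} {s : ℕ} {c H : ℕ → ℝ}
    {ζ z : ℕ → Pt m n}
    (hG : ∀ z, HasFDerivAt (saddleOp g) (saddleJac g z) z)
    (hLip : ∀ z w, ‖saddleJac g z - saddleJac g w‖ ≤ ρ * ‖z - w‖)
    (hmono : ∀ z w, σ * ‖z - w‖ ^ 2 ≤ inner ℝ (saddleOp g z - saddleOp g w) (z - w))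
    (hu : saddleOp g u = 0)
    (h : IsLFCR g z0 H0 s c H ζ z) (hs : 1 ≤ s) (hlast : z (s + 1) ≠ ζ s) (hH : 0 < H0) :
    2 * σ * ∑ k ∈ Finset.Icc 1 s, stepsize c H ζ z k * ‖z (k + 1) - u‖ ^ 2 +
      11 / 36 * ∑ k ∈ Finset.Icc 1 s, ‖z (k + 1) - ζ k‖ ^ 2 ≤ ‖z0 - u‖ ^ 2 := by
  have hmoved : ∀ k, 1 ≤ k → k ≤ s → z (k + 1) ≠ ζ k := by
    intro k hk hks
    rcases hks.lt_or_eq with hlt | rfl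
    · exact h.moved k hk hlt
    · exact hlast
  have hstep : ∀ k, 1 ≤ k → k ≤ s →
      2 * σ * (stepsize c H ζ z k * ‖z (k + 1) - u‖ ^ 2) + 11 / 36 * ‖z (k + 1) - ζ k‖ ^ 2 ≤
        ‖ζ k - u‖ ^ 2 - ‖ζ k - stepsize c H ζ z k • saddleOp g (z (k + 1)) - u‖ ^ 2 := by
    intro k hk hks
    have hb := h.estimate_bounds hG hLip hH
    have hHk : 0 < H k := hH.trans_le (hb k hks).1.1
    obtain ⟨-, -, -, h1⟩ := (h.search k hk hks).estimates hG hLip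
      (hH.trans_le (hb (k - 1) ((Nat.sub_le k 1).trans hks)).1.1)
    obtain ⟨hc, hc'⟩ := h.const_mem k hk hks
    have h2 := extragradient_step_le (u := u) hHk (hmoved k hk hks) hc hc' h1
    have h3 := hmono (z (k + 1)) u
    rw [hu, sub_zero] at h3
    have h4 : 0 ≤ stepsize c H ζ z k := by
      rw [stepsize]
      have : 0 ≤ c k := by linarith
      positivity
    rw [← stepsize] at h2
    have h5 := mul_le_mul_of_nonneg_left h3 h4
    linarith
  -- The telescoping stops before s, because no update ζ (s + 1) is required to exist; the last step
  -- is added separately and its final distance is dropped.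
  have hpartial : ∀ j, j < s →
      2 * σ * ∑ k ∈ Finset.Icc 1 j, stepsize c H ζ z k * ‖z (k + 1) - u‖ ^ 2 +
        11 / 36 * ∑ k ∈ Finset.Icc 1 j, ‖z (k + 1) - ζ k‖ ^ 2 ≤
          ‖z0 - u‖ ^ 2 - ‖ζ (j + 1) - u‖ ^ 2 := by
    intro j
    induction j with
    | zero => intro _; simp [h.init_point]
    | succ j ih =>
      intro hj
      have h1 := ih (Nat.lt_of_succ_lt hj)
      have h2 := hstep (j + 1) (Nat.le_add_left 1 j) hj.le
      rw [← h.extragrad (j + 1) (Nat.le_add_left 1 j) hj] at h2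
      rw [Finset.sum_Icc_succ_top (Nat.le_add_left 1 j),
        Finset.sum_Icc_succ_top (Nat.le_add_left 1 j)]
      linarith
  obtain ⟨j, rfl⟩ := Nat.exists_eq_add_of_le' hs
  have h1 := hpartial j (Nat.lt_succ_self j)
  have h2 := hstep (j + 1) hs le_rfl
  rw [Finset.sum_Icc_succ_top hs, Finset.sum_Icc_succ_top hs]
  nlinarith [sq_nonneg ‖ζ (j + 1) - stepsize c H ζ z (j + 1) • saddleOp g (z (j + 1 + 1)) - u‖]

/-- The convergence rate of the Lipschitz-free method for a strongly monotone operator. -/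
theorem LFCROutput.estimates {g : Obj m n} {z0 zout u : Pt m n} {H0 Hout ρ σ : ℝ} {N : ℕ}
    (hG : ∀ z, HasFDerivAt (saddleOp g) (saddleJac g z) z)
    (hLip : ∀ z w, ‖saddleJac g z - saddleJac g w‖ ≤ ρ * ‖z - w‖) (hσ : 0 < σ)
    (hmono : ∀ z w, σ * ‖z - w‖ ^ 2 ≤ inner ℝ (saddleOp g z - saddleOp g w) (z - w))
    (hu : saddleOp g u = 0) (h : LFCROutput g z0 H0 N zout Hout) (hH : 0 < H0) :
    (H0 ≤ Hout ∧ Hout ≤ max H0 (2 * ρ)) ∧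
      σ * ‖zout - u‖ ^ 2 * √(N : ℝ) ^ 3 ≤ 33 * Hout * ‖z0 - u‖ ^ 3 := by
  obtain ⟨s, c, H, ζ, z, hs, -, hlf, rfl, hend⟩ := h
  have hb := hlf.estimate_bounds hG hLip hH
  have hHs : 0 < H s := hH.trans_le (hb s le_rfl).1.1
  refine ⟨(hb s le_rfl).1, ?_⟩
  rcases hend with ⟨rfl, hlast, rfl⟩ | ⟨hstay, rfl⟩
  · have hsum := hlf.sum_le hG hLip hmono hu hs hlast hH
    have hr : ∀ k ∈ Finset.Icc 1 s, 0 < ‖z (k + 1) - ζ k‖ := by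
      intro k hk
      obtain ⟨hk1, hks⟩ := Finset.mem_Icc.1 hk
      refine norm_pos_iff.2 (sub_ne_zero.2 ?_)
      rcases hks.lt_or_eq with hlt | rfl
      · exact hlf.moved k hk1 hlt
      · exact hlast
    have hl : ∀ k ∈ Finset.Icc 1 s, ‖z (k + 1) - ζ k‖⁻¹ ≤ 33 * H s * stepsize c H ζ z k := by
      intro k hk
      have hrk := hr k hk
      obtain ⟨hk1, hks⟩ := Finset.mem_Icc.1 hk
      have hHk : 0 < H k := hH.trans_le (hb k hks).1.1
      have hle := (hb s le_rfl).2 k hks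
      have hc := (hlf.const_mem k hk1 hks).1
      rw [stepsize, ← mul_div_assoc, inv_eq_one_div, div_le_div_iff₀ hrk (by positivity)]
      have : H k ≤ 33 * H s * c k := by nlinarith
      nlinarith
    have hlpos : ∀ k ∈ Finset.Icc 1 s, 0 < stepsize c H ζ z k := by
      intro k hk
      have h1 := (inv_pos.2 (hr k hk)).trans_le (hl k hk)
      exact pos_of_mul_pos_right h1 (by positivity)
    set S := ∑ k ∈ Finset.Icc 1 s, stepsize c H ζ z k with hS
    have hSpos : 0 < S := Finset.sum_pos hlpos ⟨1, Finset.mem_Icc.2 ⟨le_rfl, hs⟩⟩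
    have hjensen : S * ‖S⁻¹ • ∑ k ∈ Finset.Icc 1 s, stepsize c H ζ z k • z (k + 1) - u‖ ^ 2 ≤
        ∑ k ∈ Finset.Icc 1 s, stepsize c H ζ z k * ‖z (k + 1) - u‖ ^ 2 := by
      have hcvx : ConvexOn ℝ Set.univ (fun w : Pt m n => ‖w - u‖ ^ 2) := by
        have h1 : ConvexOn ℝ Set.univ (fun w : Pt m n => ‖w‖ ^ 2) :=
          convexOn_univ_norm.pow (fun _ _ => norm_nonneg _) 2
        simpa [Function.comp_def, sub_eq_add_neg] using h1.translate_left (-u)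
      have h1 := hcvx.map_centerMass_le (t := Finset.Icc 1 s) (w := stepsize c H ζ z)
        (p := fun k => z (k + 1)) (fun k hk => (hlpos k hk).le) hSpos (fun _ _ => Set.mem_univ _)
      simp only [Finset.centerMass, smul_eq_mul, Function.comp_apply] at h1
      rw [← hS] at h1
      calc S * _ ≤ S * _ := mul_le_mul_of_nonneg_left h1 hSpos.le
        _ = _ := by rw [← mul_assoc, mul_inv_cancel₀ hSpos.ne', one_mul]
    set e := ‖S⁻¹ • ∑ k ∈ Finset.Icc 1 s, stepsize c H ζ z k • z (k + 1) - u‖ with he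
    set d := ‖z0 - u‖ with hd
    have hsqpos : 0 < ∑ k ∈ Finset.Icc 1 s, ‖z (k + 1) - ζ k‖ ^ 2 :=
      Finset.sum_pos (fun k hk => pow_pos (hr k hk) 2) ⟨1, Finset.mem_Icc.2 ⟨le_rfl, hs⟩⟩
    have hσS : 2 * σ * (S * e ^ 2) ≤
        2 * σ * ∑ k ∈ Finset.Icc 1 s, stepsize c H ζ z k * ‖z (k + 1) - u‖ ^ 2 :=
      mul_le_mul_of_nonneg_left hjensen (by positivity)
    have hσS0 : 0 ≤ 2 * σ * (S * e ^ 2) := by positivity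
    have hdpos : 0 < d := by
      refine lt_of_le_of_ne (norm_nonneg _) fun h0 => ?_
      rw [← h0] at hsum
      linarith
    -- The squared steps sum to at most (36/11) d², which is below 4 d².
    have hcard := card_mul_sqrt_le_sum_inv (Finset.Icc 1 s) hr hdpos (by linarith)
    rw [Nat.card_Icc, Nat.add_sub_cancel] at hcard
    have hinv : ∑ k ∈ Finset.Icc 1 s, ‖z (k + 1) - ζ k‖⁻¹ ≤ 33 * H s * S := by
      rw [hS, Finset.mul_sum]
      exact Finset.sum_le_sum hl
    calc σ * e ^ 2 * √(s : ℝ) ^ 3 ≤ σ * e ^ 2 * (2 * d * (33 * H s * S)) := by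
          refine mul_le_mul_of_nonneg_left (hcard.trans ?_) (by positivity)
          exact mul_le_mul_of_nonneg_left hinv (by positivity)
      _ = 33 * H s * d * (2 * σ * (S * e ^ 2)) := by ring
      _ ≤ 33 * H s * d * d ^ 2 := mul_le_mul_of_nonneg_left (by linarith) (by positivity)
      _ = _ := by ring
  -- For a step of length zero the cubic equation reduces to F = 0, and strong monotonicity forces
  -- the point to be u.
  · have hzero : saddleOp g (z (s + 1)) = 0 := by
      have h1 := ((hlf.search s hs le_rfl).estimates hG hLip
        (hH.trans_le (hb (s - 1) (Nat.sub_le s 1)).1.1)).2.2.1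
      rw [CubicEq, ← hstay] at h1
      simpa using h1
    have h2 := hmono (z (s + 1)) u
    rw [hzero, hu, sub_zero, inner_zero_left] at h2
    have h3 : 0 ≤ ‖z (s + 1) - u‖ ^ 2 := by positivity
    have h4 : ‖z (s + 1) - u‖ ^ 2 = 0 := by nlinarith
    rw [h4]
    have : 0 ≤ 33 * H s * ‖z0 - u‖ ^ 3 := by positivity
    simpa using this

theorem sigmaReg_zero (ε D : ℝ) : sigmaReg ε D 0 = 0 := by simp [sigmaReg]

theorem sigmaReg_pos {ε D : ℝ} (hε : 0 < ε) (hD : 0 < D) {k : ℕ} (hk : 1 ≤ k) :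
    0 < sigmaReg ε D k := by
  rw [sigmaReg, if_neg (by omega)]
  positivity

theorem sigmaReg_nonneg {ε D : ℝ} (hε : 0 < ε) (hD : 0 < D) (k : ℕ) : 0 ≤ sigmaReg ε D k := by
  rw [sigmaReg]
  split_ifs <;> positivity

/-- The factor 4 is attained at k = 0, where σ_0 = 0; for k ≥ 1 it would be 3. -/
theorem sigmaReg_succ_sub {ε D : ℝ} (hε : 0 < ε) (hD : 0 < D) (k : ℕ) :
    0 < sigmaReg ε D (k + 1) - sigmaReg ε D k ∧
      sigmaReg ε D (k + 1) - sigmaReg ε D k ≤ 4 * (ε / (41 * D)) * 4 ^ k := by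
  have h1 : 0 < ε / (41 * D) := by positivity
  have h2 : 0 < ε / (41 * D) * 4 ^ k := by positivity
  rw [sigmaReg, if_neg (Nat.succ_ne_zero k), sigmaReg, pow_succ]
  split_ifs <;> constructor <;> linarith

/-! ### One round of FF-CR and its final gradient. -/

section Round

variable {f : Obj m n} {ρ ε M0 D : ℝ} {z0 : Pt m n} {K : ℕ} {z zbar ztil : ℕ → Pt m n}
  {H M : ℕ → ℝ} {N : ℕ → ℕ}

theorem saddleOp_regObj_strongly_monotone (hf : Differentiable ℝ (joint f))
    (hconv : ∀ y, ConvexOn ℝ Set.univ (fun x => f x y))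
    (hconc : ∀ x, ConcaveOn ℝ Set.univ (fun y => f x y)) (σ : ℝ) (c z w : Pt m n) :
    σ * ‖z - w‖ ^ 2 ≤
      inner ℝ (saddleOp (regObj f σ c) z - saddleOp (regObj f σ c) w) (z - w) := by
  have h1 := saddleOp_monotone hf hconv hconc z w
  have h2 : saddleOp (regObj f σ c) z - saddleOp (regObj f σ c) w =
      (saddleOp f z - saddleOp f w) + σ • (z - w) := by
    rw [saddleOp_regObj hf, saddleOp_regObj hf]
    module
  rw [h2, inner_add_left, real_inner_smul_left, real_inner_self_eq_norm_sq]
  linarith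

theorem hasFDerivAt_saddleOp_regObj (hf : ContDiff ℝ 2 (joint f)) (σ : ℝ) (c z : Pt m n) :
    HasFDerivAt (saddleOp (regObj f σ c)) (saddleJac (regObj f σ c) z) z := by
  have h : saddleOp (regObj f σ c) = fun z => saddleOp f z + σ • (z - c) :=
    funext (saddleOp_regObj (hf.differentiable two_ne_zero) σ c)
  rw [saddleJac_regObj hf, h]
  exact (hasFDerivAt_saddleOp hf z).add (((hasFDerivAt_id z).sub_const c).const_smul σ)

theorem norm_saddleJac_regObj_sub_le (hf : ContDiff ℝ 2 (joint f))
    (hLip : ∀ z z' : Pt m n, ‖fullHess f z - fullHess f z'‖ ≤ ρ * ‖z - z'‖) (σ : ℝ)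
    (c z w : Pt m n) :
    ‖saddleJac (regObj f σ c) z - saddleJac (regObj f σ c) w‖ ≤ ρ * ‖z - w‖ := by
  rw [saddleJac_regObj hf, saddleJac_regObj hf, add_sub_add_right_eq_sub]
  exact norm_saddleJac_sub_le hf hLip z w

theorem exists_saddleOp_regObj_eq_zero (hf : ContDiff ℝ 2 (joint f))
    (hconv : ∀ y, ConvexOn ℝ Set.univ (fun x => f x y))
    (hconc : ∀ x, ConcaveOn ℝ Set.univ (fun y => f x y)) {σ : ℝ} (hσ : 0 < σ) (c : Pt m n) :
    ∃ u, saddleOp (regObj f σ c) u = 0 := by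
  refine exists_zero_of_strongly_monotone ?_ hσ
    (saddleOp_regObj_strongly_monotone (hf.differentiable two_ne_zero) hconv hconc σ c)
  rw [show saddleOp (regObj f σ c) = fun z => saddleOp f z + σ • (z - c) from
    funext (saddleOp_regObj (hf.differentiable two_ne_zero) σ c)]
  exact (contDiff_saddleOp hf).add ((contDiff_id.sub contDiff_const).const_smul σ)

/-- Regularization adds a constant multiple of the identity to the Jacobian, so ρ serves for every
subproblem. The difference quotient fed to the line search is at most ρ too. -/
theorem IsFFCRRound.estimate_bounds (h : IsFFCRRound f ε z0 M0 D K z zbar ztil H M N)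
    (hf : ContDiff ℝ 2 (joint f))
    (hconv : ∀ y, ConvexOn ℝ Set.univ (fun x => f x y))
    (hconc : ∀ x, ConcaveOn ℝ Set.univ (fun y => f x y)) (hρ : 0 < ρ)
    (hLip : ∀ z z' : Pt m n, ‖fullHess f z - fullHess f z'‖ ≤ ρ * ‖z - z'‖)
    (hε : 0 < ε) (hD : 0 < D) (hM0 : 0 < M0) :
    ∀ k ≤ K, (M0 ≤ H k ∧ H k ≤ max M0 (2 * ρ)) ∧ (M0 ≤ M k ∧ M k ≤ max M0 (2 * ρ)) := by
  intro k
  induction k with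
  | zero =>
    intro _
    rw [h.init_H, h.init_M]
    exact ⟨⟨le_rfl, le_max_left _ _⟩, le_rfl, le_max_left _ _⟩
  | succ k ih =>
    intro hk
    obtain ⟨⟨h1, h2⟩, h3, h4⟩ := ih (Nat.le_of_succ_le hk)
    have hk1 : 1 ≤ k + 1 := Nat.le_add_left 1 k
    have hσ := sigmaReg_pos hε hD hk1
    obtain ⟨u, hu⟩ := exists_saddleOp_regObj_eq_zero hf hconv hconc hσ (zbar (k + 1))
    have hG := hasFDerivAt_saddleOp_regObj hf (sigmaReg ε D (k + 1)) (zbar (k + 1))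
    have hL := norm_saddleJac_regObj_sub_le hf hLip (sigmaReg ε D (k + 1)) (zbar (k + 1))
    obtain ⟨⟨h5, h6⟩, -⟩ := (h.solve (k + 1) hk1 hk).estimates hG hL hσ
      (saddleOp_regObj_strongly_monotone (hf.differentiable two_ne_zero) hconv hconc _ _) hu
      (by simpa using hM0.trans_le h1)
    obtain ⟨h7, h8, -⟩ := (h.search (k + 1) hk1 hk).estimates hG hL
      (lt_max_of_lt_left (by simpa using hM0.trans_le h3))
    rw [Nat.add_sub_cancel] at h5 h6 h7 h8
    have hq : ‖saddleJac f (z (k + 1)) - saddleJac f z0‖ / ‖z (k + 1) - z0‖ ≤ ρ :=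
      div_le_of_le_mul₀ (norm_nonneg _) hρ.le (norm_saddleJac_sub_le hf hLip _ _)
    refine ⟨⟨h1.trans h5, h6.trans (max_le h2 (le_max_right _ _))⟩,
      h3.trans ((le_max_left _ _).trans h7), h8.trans (max_le (max_le h4 ?_) (le_max_right _ _))⟩
    exact le_max_of_le_right (by linarith)

/-- The regularized operators of a round differ by a proximal term at the current point. -/
theorem IsFFCRRound.saddleOp_succ (h : IsFFCRRound f ε z0 M0 D K z zbar ztil H M N)
    (hf : Differentiable ℝ (joint f)) (hε : 0 < ε) (hD : 0 < D) {k : ℕ} (hk : k < K)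
    (w : Pt m n) :
    saddleOp (regObj f (sigmaReg ε D (k + 1)) (zbar (k + 1))) w =
      saddleOp (regObj f (sigmaReg ε D k) (zbar k)) w +
        (sigmaReg ε D (k + 1) - sigmaReg ε D k) • (w - z k) := by
  have hσ := (sigmaReg_pos hε hD (Nat.le_add_left 1 k)).ne'
  rw [saddleOp_regObj hf, saddleOp_regObj hf, h.average (k + 1) (Nat.le_add_left 1 k) hk,
    Nat.add_sub_cancel, add_assoc]
  congr 1
  -- This relation is the purpose of γ: σ_{k+1} z̄_{k+1} = σ_k z̄_k + (σ_{k+1} - σ_k) z_k.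
  have hγ : sigmaReg ε D (k + 1) * gammaReg ε D (k + 1) =
      sigmaReg ε D (k + 1) - sigmaReg ε D k := by
    rw [gammaReg, Nat.add_sub_cancel]
    field_simp
  have h1 : sigmaReg ε D k = sigmaReg ε D (k + 1) -
      sigmaReg ε D (k + 1) * gammaReg ε D (k + 1) := by rw [hγ]; ring
  rw [h1]
  module

/-- A zero of the operator with an added proximal term at `c` is not farther from `c`. -/
theorem norm_sub_zero_le_of_prox {E : Type*} [NormedAddCommGroup E] [InnerProductSpace ℝ E]
    {G : E → E} {c u v : E} {τ : ℝ} (hτ : 0 < τ) (hu : G u = 0) (hv : G v + τ • (v - c) = 0)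
    (hmono : 0 ≤ inner ℝ (G v - G u) (v - u)) : ‖c - v‖ ≤ ‖c - u‖ := by
  have h1 : G v = -(τ • (v - c)) := eq_neg_of_add_eq_zero_left hv
  rw [hu, sub_zero, h1, inner_neg_left, real_inner_smul_left] at hmono
  -- Equivalently ‖v - c‖² ≤ ⟨v - c, u - c⟩, and Cauchy-Schwarz finishes.
  have h2 : inner ℝ (v - c) (v - u) ≤ 0 := by
    by_contra hcon
    nlinarith [mul_pos hτ (not_le.1 hcon)]
  have h3 : v - u = (v - c) + (c - u) := by abel
  rw [h3, inner_add_right, real_inner_self_eq_norm_sq] at h2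
  have h4 := neg_le_of_abs_le (abs_real_inner_le_norm (v - c) (c - u))
  rw [norm_sub_rev c v]
  by_contra hcon
  have h5 : ‖c - u‖ < ‖v - c‖ := not_le.1 hcon
  nlinarith [norm_nonneg (c - u)]

theorem le_sqrt_pow_three_of_innerCount {k : ℕ} {H : ℝ} (hH : 0 < H) (hε : 0 < ε) (hD : 0 < D)
    (hk : 1 ≤ k) :
    33 * √3 * (512 / 8 ^ k) * H * D ≤ sigmaReg ε D k * √(innerCount ε D k H : ℝ) ^ 3 := by
  have hσ := sigmaReg_pos hε hD hk
  have h8 : (8 : ℝ) ^ (3 - (k : ℤ)) = 512 / 8 ^ k := by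
    rw [zpow_sub₀ (by norm_num), zpow_natCast]
    norm_num
  have h1 := Nat.le_ceil ((33 * √3 * (8 : ℝ) ^ (3 - (k : ℤ)) * H * D / sigmaReg ε D k) ^
    (2 / 3 : ℝ))
  rw [← innerCount, h8] at h1
  set X := 33 * √3 * (512 / 8 ^ k) * H * D / sigmaReg ε D k with hX
  have hXpos : 0 < X := by positivity
  have h2 : X ≤ √(innerCount ε D k H : ℝ) ^ 3 := by
    have h3 : X = (X ^ (2 / 3 : ℝ)) ^ (3 / 2 : ℝ) := by
      rw [← Real.rpow_mul hXpos.le]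
      norm_num
    have h4 : √(innerCount ε D k H : ℝ) ^ 3 = (innerCount ε D k H : ℝ) ^ (3 / 2 : ℝ) := by
      rw [Real.sqrt_eq_rpow, ← Real.rpow_natCast, ← Real.rpow_mul (Nat.cast_nonneg _)]
      norm_num
    rw [h3, h4]
    exact Real.rpow_le_rpow (by positivity) h1 (by norm_num)
  calc _ = sigmaReg ε D k * X := by rw [hX]; field_simp
    _ ≤ _ := mul_le_mul_of_nonneg_left h2 hσ.le

/-- In a round with a large enough guess the inner iterates approach the regularized solutions
geometrically. -/
theorem IsFFCRRound.exists_zeros (h : IsFFCRRound f ε z0 M0 D K z zbar ztil H M N)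
    (hf : ContDiff ℝ 2 (joint f))
    (hconv : ∀ y, ConvexOn ℝ Set.univ (fun x => f x y))
    (hconc : ∀ x, ConcaveOn ℝ Set.univ (fun y => f x y)) (hρ : 0 < ρ)
    (hLip : ∀ z z' : Pt m n, ‖fullHess f z - fullHess f z'‖ ≤ ρ * ‖z - z'‖)
    (hε : 0 < ε) (hD : 0 < D) (hM0 : 0 < M0) {zs : Pt m n} (hzs : IsSaddle f zs)
    (hDzs : ‖z0 - zs‖ ≤ D) :
    ∃ u : ℕ → Pt m n, ∀ k ≤ K,
      saddleOp (regObj f (sigmaReg ε D k) (zbar k)) (u k) = 0 ∧ ‖z k - u k‖ ≤ D / 8 ^ k ∧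
        (k < K → ‖z k - u (k + 1)‖ ≤ D / 8 ^ k) := by
  have hdiff := hf.differentiable two_ne_zero
  -- At k = 0 there is no regularization and zeros need not be unique, so the given saddle point is
  -- selected.
  have hex : ∀ k, ∃ u, saddleOp (regObj f (sigmaReg ε D k) (zbar k)) u = 0 ∧
      (k = 0 → u = zs) := by
    intro k
    rcases Nat.eq_zero_or_pos k with rfl | hk
    · refine ⟨zs, ?_, fun _ => rfl⟩
      rw [sigmaReg_zero, saddleOp_regObj hdiff, hzs.saddleOp_eq_zero hdiff]
      simp
    · obtain ⟨u, hu⟩ := exists_saddleOp_regObj_eq_zero hf hconv hconc (sigmaReg_pos hε hD hk)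
        (zbar k)
      exact ⟨u, hu, fun h0 => absurd h0 hk.ne'⟩
  choose u hu hu0 using hex
  have hsm := fun σ c => saddleOp_regObj_strongly_monotone (f := f) hdiff hconv hconc σ c
  have hnext : ∀ k < K, ‖z k - u (k + 1)‖ ≤ ‖z k - u k‖ := by
    intro k hk
    refine norm_sub_zero_le_of_prox (sigmaReg_succ_sub hε hD k).1 (hu k) ?_
      (le_trans (mul_nonneg (sigmaReg_nonneg hε hD k) (by positivity)) (hsm _ _ _ _))
    rw [← h.saddleOp_succ hdiff hε hD hk]
    exact hu (k + 1)
  have hbound : ∀ k ≤ K, ‖z k - u k‖ ≤ D / 8 ^ k := by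
    intro k
    induction k with
    | zero =>
      intro _
      rw [hu0 0 rfl, h.init_z]
      simpa using hDzs
    | succ k ih =>
      intro hk
      have hk1 : 1 ≤ k + 1 := Nat.le_add_left 1 k
      have hσ := sigmaReg_pos hε hD hk1
      have hb := h.estimate_bounds hf hconv hconc hρ hLip hε hD hM0
      have hHpos : 0 < H (k + 1) := hM0.trans_le (hb (k + 1) hk).1.1
      obtain ⟨-, h1⟩ := (h.solve (k + 1) hk1 hk).estimates
        (hasFDerivAt_saddleOp_regObj hf _ _) (norm_saddleJac_regObj_sub_le hf hLip _ _) hσ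
        (hsm _ _) (hu (k + 1))
        (by simpa using hM0.trans_le (hb k (Nat.le_of_succ_le hk)).1.1)
      rw [Nat.add_sub_cancel, h.count (k + 1) hk1 hk] at h1
      have h2 := le_sqrt_pow_three_of_innerCount (k := k + 1) hHpos hε hD hk1
      have h3 : ‖z k - u (k + 1)‖ ≤ D / 8 ^ k := (hnext k hk).trans (ih (Nat.le_of_succ_le hk))
      set b := D / 8 ^ k with hb'
      have hbpos : 0 < b := by positivity
      set e := ‖z (k + 1) - u (k + 1)‖ with he
      have h4 : 33 * √3 * (512 / 8 ^ (k + 1)) * H (k + 1) * D = 33 * H (k + 1) * b * (64 * √3) := by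
        rw [hb', pow_succ]
        field_simp
        norm_num
      rw [h4] at h2
      -- The iteration count turns the LF-CR rate into 64√3 e² ≤ b²; only 64 e² ≤ b² is kept, which
      -- is the contraction by 8.
      have h5 : 33 * H (k + 1) * b * (64 * e ^ 2) ≤ 33 * H (k + 1) * b * b ^ 2 := by
        have h6 : (1 : ℝ) ≤ √3 := Real.one_le_sqrt.2 (by norm_num)
        calc 33 * H (k + 1) * b * (64 * e ^ 2)
            ≤ 33 * H (k + 1) * b * (64 * e ^ 2) * √3 := le_mul_of_one_le_right (by positivity) h6
          _ = e ^ 2 * (33 * H (k + 1) * b * (64 * √3)) := by ring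
          _ ≤ e ^ 2 * _ := mul_le_mul_of_nonneg_left h2 (by positivity)
          _ = _ := by ring
          _ ≤ _ := h1
          _ ≤ 33 * H (k + 1) * b ^ 3 := by gcongr
          _ = _ := by ring
      have h7 := le_of_mul_le_mul_left h5 (by positivity)
      have h8 : e ≤ b / 8 := le_of_sq_le_sq (by linarith) (by positivity)
      calc e ≤ b / 8 := h8
        _ = D / 8 ^ (k + 1) := by rw [hb', pow_succ]; field_simp
  exact ⟨u, fun k hk => ⟨hu k, hbound k hk, fun hk' => (hnext k hk').trans (hbound k hk)⟩⟩

theorem IsFFCRRound.saddleOp_eq_sum (h : IsFFCRRound f ε z0 M0 D K z zbar ztil H M N)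
    (hf : Differentiable ℝ (joint f)) (hε : 0 < ε) (hD : 0 < D) (w : Pt m n) :
    ∀ k ≤ K, saddleOp (regObj f (sigmaReg ε D k) (zbar k)) w = saddleOp f w +
      ∑ j ∈ Finset.range k, (sigmaReg ε D (j + 1) - sigmaReg ε D j) • (w - z j) := by
  intro k
  induction k with
  | zero => intro _; simp [sigmaReg_zero, saddleOp_regObj hf]
  | succ k ih =>
    intro hk
    rw [h.saddleOp_succ hf hε hD hk, ih (Nat.le_of_succ_le hk), Finset.sum_range_succ, add_assoc]

/-- The exit test in exponential form, with the factor √(12/11) ≥ 1 given away. For J = 0 the last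
bound is trivial, whatever the logarithm of 0 is. -/
theorem le_pow_of_outerCount_le {J M : ℝ} {k : ℕ} (hε : 0 < ε) (hD : 0 < D) (hM : 0 < M)
    (hJ : 0 ≤ J) (h : outerCount ε D J M ≤ k) :
    32 * M * D ^ 2 / ε ≤ 64 ^ k ∧ 8 * M * D ^ 2 / ε ≤ 8 ^ k ∧ 4 * J * D / ε ≤ 8 ^ k := by
  rw [outerCount, Int.ceil_le, max_le_iff, max_le_iff] at h
  obtain ⟨h1, h2, h3⟩ := h
  simp only [Int.cast_natCast] at h1 h2 h3
  refine ⟨?_, ?_, ?_⟩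
  · simpa using (Real.logb_le_iff_le_rpow (by norm_num) (by positivity)).1 h1
  · simpa using (Real.logb_le_iff_le_rpow (by norm_num) (by positivity)).1 h2
  · have hc : (1 : ℝ) ≤ √(12 / 11) := Real.one_le_sqrt.2 (by norm_num)
    rcases hJ.eq_or_lt with rfl | hJpos
    · simp
    · have h4 := (Real.logb_le_iff_le_rpow (by norm_num) (by positivity)).1 h3
      rw [Real.rpow_natCast] at h4
      refine le_trans ?_ h4
      gcongr
      linarith

/-- A round whose guess bounds the distance to a saddle point ends with a small gradient. -/
theorem IsFFCRRound.norm_saddleOp_le (h : IsFFCRRound f ε z0 M0 D K z zbar ztil H M N)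
    (hf : ContDiff ℝ 2 (joint f))
    (hconv : ∀ y, ConvexOn ℝ Set.univ (fun x => f x y))
    (hconc : ∀ x, ConcaveOn ℝ Set.univ (fun y => f x y)) (hρ : 0 < ρ)
    (hLip : ∀ z z' : Pt m n, ‖fullHess f z - fullHess f z'‖ ≤ ρ * ‖z - z'‖)
    (hε : 0 < ε) (hD : 0 < D) (hM0 : 0 < M0) {zs : Pt m n} (hzs : IsSaddle f zs)
    (hDzs : ‖z0 - zs‖ ≤ D) : ‖saddleOp f (z K)‖ ≤ ε := by
  have hdiff := hf.differentiable two_ne_zero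
  obtain ⟨u, hu⟩ := h.exists_zeros hf hconv hconc hρ hLip hε hD hM0 hzs hDzs
  have hb := h.estimate_bounds hf hconv hconc hρ hLip hε hD hM0
  have hstep : ∀ k, k < K → ‖z (k + 1) - z k‖ ≤ 9 / 8 * (D / 8 ^ k) := by
    intro k hk
    have h1 := (hu (k + 1) hk).2.1
    have h2 := (hu k hk.le).2.2 hk
    have h3 : ‖z (k + 1) - z k‖ ≤ ‖z (k + 1) - u (k + 1)‖ + ‖z k - u (k + 1)‖ := by
      have : z (k + 1) - z k = (z (k + 1) - u (k + 1)) - (z k - u (k + 1)) := by abel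
      rw [this]
      exact norm_sub_le _ _
    have h4 : D / 8 ^ (k + 1) = 1 / 8 * (D / 8 ^ k) := by rw [pow_succ]; field_simp
    linarith
  -- Geometric tail of the step bounds: (9/8) · 1/(1 - 1/8) = 9/7.
  have hdist : ∀ j, j ≤ K → ‖z K - z j‖ ≤ 9 / 7 * (D / 8 ^ j) := by
    intro j hj
    induction hj using Nat.decreasingInduction with
    | self => simp; positivity
    | of_succ j hj ih =>
      have h1 := hstep j hj
      have h2 : ‖z K - z j‖ ≤ ‖z K - z (j + 1)‖ + ‖z (j + 1) - z j‖ :=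
        norm_sub_le_norm_sub_add_norm_sub _ _ _
      have h4 : D / 8 ^ (j + 1) = 1 / 8 * (D / 8 ^ j) := by rw [pow_succ]; field_simp
      linarith
  have hK := h.one_le
  have hMpos : 0 < M K := hM0.trans_le (hb K le_rfl).2.1
  obtain ⟨hc1, hc2, hc3⟩ := le_pow_of_outerCount_le hε hD hMpos (norm_nonneg _) h.leave
  set a := D / 8 ^ K with ha
  have hapos : 0 < a := by positivity
  set J := ‖saddleJac f z0‖ with hJ
  have hJ0 : 0 ≤ J := norm_nonneg _
  have e1 : M K * a ^ 2 ≤ ε / 32 := by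
    rw [div_le_iff₀ hε] at hc1
    have : M K * a ^ 2 = M K * D ^ 2 / 64 ^ K := by
      rw [ha, div_pow, ← pow_mul, mul_comm K 2, pow_mul]
      norm_num
      ring
    rw [this, div_le_iff₀ (by positivity)]
    linarith
  have e2 : M K * D * a ≤ ε / 8 := by
    rw [div_le_iff₀ hε] at hc2
    have : M K * D * a = M K * D ^ 2 / 8 ^ K := by rw [ha]; ring
    rw [this, div_le_iff₀ (by positivity)]
    linarith
  have e3 : J * a ≤ ε / 4 := by
    rw [div_le_iff₀ hε] at hc3
    have : J * a = J * D / 8 ^ K := by rw [ha]; ring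
    rw [this, div_le_iff₀ (by positivity)]
    linarith
  have e4 : sigmaReg ε D K * a ≤ ε / 41 := by
    have h1 : sigmaReg ε D K * a = ε / 41 * (4 ^ K / 8 ^ K) := by
      rw [sigmaReg, if_neg (by omega), ha]
      field_simp
    have h2 : (4 : ℝ) ^ K / 8 ^ K ≤ 1 := by
      rw [div_le_one (by positivity)]
      gcongr
      norm_num
    rw [h1]
    exact mul_le_of_le_one_right (by positivity) h2
  have hσ := sigmaReg_pos hε hD hK
  have hG := hasFDerivAt_saddleOp_regObj hf (sigmaReg ε D K) (zbar K)
  have hL := norm_saddleJac_regObj_sub_le hf hLip (sigmaReg ε D K) (zbar K)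
  obtain ⟨hM1, -, hcub, hres⟩ := (h.search K hK le_rfl).estimates hG hL
    (lt_max_of_lt_left (hM0.trans_le (hb (K - 1) (Nat.sub_le K 1)).2.1))
  -- This is why the line search starts from at least the difference quotient: M K replaces ρ here.
  have hq : ‖saddleJac f (z K) - saddleJac f z0‖ ≤ M K * (9 / 7 * D) := by
    have h1 : ‖z K - z0‖ ≤ 9 / 7 * D := by simpa [h.init_z] using hdist 0 (Nat.zero_le K)
    refine le_trans ?_ (mul_le_mul_of_nonneg_left h1 hMpos.le)
    rcases eq_or_ne (z K) z0 with heq | hne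
    · simp [heq]
    · exact (div_le_iff₀ (norm_pos_iff.2 (sub_ne_zero.2 hne))).1 ((le_max_right _ _).trans hM1)
  have hr : ‖ztil K - z K‖ ≤ 101 / 100 * a := by
    refine (cubic_step_le hMpos (hu K le_rfl).1 ?_ hres).trans ?_
    · exact le_trans (mul_nonneg hσ.le (by positivity))
        (saddleOp_regObj_strongly_monotone hdiff hconv hconc _ _ _ _)
    · have := (hu K le_rfl).2.1
      linarith
  set r := ‖ztil K - z K‖ with hr'
  have hr0 : 0 ≤ r := norm_nonneg _
  have hjac : ‖saddleJac (regObj f (sigmaReg ε D K) (zbar K)) (z K)‖ ≤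
      J + M K * (9 / 7 * D) + sigmaReg ε D K := by
    rw [saddleJac_regObj hf]
    refine (norm_add_le _ _).trans (add_le_add ?_ ?_)
    · have : saddleJac f (z K) = saddleJac f z0 + (saddleJac f (z K) - saddleJac f z0) := by abel
      rw [this]
      exact (norm_add_le _ _).trans (by gcongr)
    · rw [norm_smul, Real.norm_eq_abs, abs_of_pos hσ]
      exact mul_le_of_le_one_right hσ.le ContinuousLinearMap.norm_id_le
  have hFK : ‖saddleOp (regObj f (sigmaReg ε D K) (zbar K)) (z K)‖ ≤
      (J + M K * (9 / 7 * D) + sigmaReg ε D K) * r + 6 * M K * r ^ 2 := by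
    have h1 : saddleOp (regObj f (sigmaReg ε D K) (zbar K)) (z K) =
        -(saddleJac (regObj f (sigmaReg ε D K) (zbar K)) (z K) (ztil K - z K) +
          (6 * M K * r) • (ztil K - z K)) := by
      rw [eq_neg_iff_add_eq_zero, ← add_assoc]
      exact hcub
    rw [h1, norm_neg]
    refine (norm_add_le _ _).trans (add_le_add ?_ ?_)
    · exact (ContinuousLinearMap.le_opNorm _ _).trans (mul_le_mul_of_nonneg_right hjac hr0)
    · rw [norm_smul, Real.norm_eq_abs, abs_of_nonneg (by positivity), ← hr']
      exact le_of_eq (by ring)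
  -- The j-th term is at most (4/41)(9/7) ε (4/8)^j = (36/287) ε / 2^j, and the geometric sum
  -- doubles the constant.
  have hprox : ‖∑ j ∈ Finset.range K, (sigmaReg ε D (j + 1) - sigmaReg ε D j) • (z K - z j)‖ ≤
      72 / 287 * ε := by
    have h1 : ∀ j ∈ Finset.range K,
        ‖(sigmaReg ε D (j + 1) - sigmaReg ε D j) • (z K - z j)‖ ≤
          36 / 287 * ε * (1 / 2 : ℝ) ^ j := by
      intro j hj
      have h2 := sigmaReg_succ_sub hε hD j
      rw [norm_smul, Real.norm_eq_abs, abs_of_pos h2.1]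
      calc _ ≤ (4 * (ε / (41 * D)) * 4 ^ j) * (9 / 7 * (D / 8 ^ j)) :=
            mul_le_mul h2.2 (hdist j (Finset.mem_range.1 hj).le) (norm_nonneg _) (by positivity)
        _ = _ := by
            rw [show (8 : ℝ) = 4 * 2 by norm_num, mul_pow, one_div, inv_pow]
            field_simp
            norm_num
    refine (norm_sum_le _ _).trans ((Finset.sum_le_sum h1).trans ?_)
    rw [← Finset.mul_sum]
    have h3 := sum_geometric_two_le K
    have h4 : 0 ≤ 36 / 287 * ε := by positivity
    linarith [mul_le_mul_of_nonneg_left h3 h4]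
  have hfin : saddleOp f (z K) = saddleOp (regObj f (sigmaReg ε D K) (zbar K)) (z K) -
      ∑ j ∈ Finset.range K, (sigmaReg ε D (j + 1) - sigmaReg ε D j) • (z K - z j) := by
    rw [h.saddleOp_eq_sum hdiff hε hD (z K) K le_rfl, add_sub_cancel_right]
  have hlin : (J + M K * (9 / 7 * D) + sigmaReg ε D K) * r + 6 * M K * r ^ 2 ≤
      (J + M K * (9 / 7 * D) + sigmaReg ε D K) * (101 / 100 * a) +
        6 * M K * (101 / 100 * a) ^ 2 := by gcongr
  rw [hfin]
  refine (norm_sub_le _ _).trans ((add_le_add hFK hprox).trans ?_)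
  -- With `e1` to `e4` the contributions of J, M K · D, σ, the cubic term and the proximal sum are
  -- about 0.253, 0.162, 0.025, 0.191 and 0.251 times ε, in total below ε.
  linarith

end Round

end Methods

/-! ### Iteration counts. -/

section Complexity

variable {m n : ℕ} {f : Obj m n} {ρ ε M0 D : ℝ} {z0 : Pt m n} {K : ℕ} {z zbar ztil : ℕ → Pt m n}
  {H M : ℕ → ℝ} {N : ℕ → ℕ}

theorem outerCount_mono {J D D' M M' : ℝ} (hε : 0 < ε) (hD : 0 < D) (hM : 0 < M) (hJ : 0 ≤ J)
    (hDD : D ≤ D') (hMM : M ≤ M') : outerCount ε D J M ≤ outerCount ε D' J M' := by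
  have hM' : 0 < M' := hM.trans_le hMM
  unfold outerCount
  refine Int.ceil_mono (max_le_max ?_ (max_le_max ?_ ?_))
  · exact Real.logb_le_logb_of_le (by norm_num) (by positivity) (by gcongr)
  · exact Real.logb_le_logb_of_le (by norm_num) (by positivity) (by gcongr)
  · rcases hJ.eq_or_lt with rfl | hJpos
    · simp
    · have : 0 < √(12 / 11 : ℝ) := Real.sqrt_pos.2 (by norm_num)
      exact Real.logb_le_logb_of_le (by norm_num) (by positivity) (by gcongr)

/-- The 1 pays for the ceiling, and 1353 = 33 · 41. The factor 8^{3-k}/4^k = 512/32^k, raised to the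
power 2/3, is at most 64/8^k because 32² ≥ 8³. -/
theorem innerCount_le {k : ℕ} {D' H L : ℝ} (hε : 0 < ε) (hD : 0 < D) (hH : 0 < H) (hk : 1 ≤ k)
    (hDD : D ≤ D') (hHL : H ≤ L) :
    (innerCount ε D k H : ℝ) ≤
      1 + (1353 * √3 * L * D' ^ 2 / ε) ^ (2 / 3 : ℝ) * (64 * (1 / 8) ^ k) := by
  have hσ := sigmaReg_pos hε hD hk
  have hX : 0 ≤ 33 * √3 * (8 : ℝ) ^ (3 - (k : ℤ)) * H * D / sigmaReg ε D k := by positivity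
  refine (Nat.ceil_lt_add_one (Real.rpow_nonneg hX _)).le.trans ?_
  rw [add_comm]
  gcongr
  have hL : 0 < L := hH.trans_le hHL
  have hY : 0 ≤ 1353 * √3 * L * D' ^ 2 / ε := by positivity
  have h1 : 33 * √3 * (8 : ℝ) ^ (3 - (k : ℤ)) * H * D / sigmaReg ε D k ≤
      1353 * √3 * L * D' ^ 2 / ε * (512 / 32 ^ k) := by
    have h8 : (8 : ℝ) ^ (3 - (k : ℤ)) = 512 / 8 ^ k := by
      rw [zpow_sub₀ (by norm_num), zpow_natCast]
      norm_num
    have h2 : 33 * √3 * (8 : ℝ) ^ (3 - (k : ℤ)) * H * D / sigmaReg ε D k =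
        1353 * √3 * H * D ^ 2 / ε * (512 / 32 ^ k) := by
      rw [h8, sigmaReg, if_neg (by omega), show (32 : ℝ) = 8 * 4 by norm_num, mul_pow]
      field_simp
      norm_num
    rw [h2]
    gcongr
  have h3 : (512 / 32 ^ k : ℝ) ^ (2 / 3 : ℝ) ≤ 64 * (1 / 8) ^ k := by
    have h4 : (64 * (1 / 8) ^ k : ℝ) = (((64 * (1 / 8) ^ k : ℝ)) ^ (3 / 2 : ℝ)) ^ (2 / 3 : ℝ) := by
      rw [← Real.rpow_mul (by positivity)]
      norm_num
    rw [h4]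
    refine Real.rpow_le_rpow (by positivity) ?_ (by norm_num)
    refine le_of_sq_le_sq ?_ (by positivity)
    have h5 : ((64 * (1 / 8) ^ k : ℝ) ^ (3 / 2 : ℝ)) ^ 2 = (64 * (1 / 8) ^ k : ℝ) ^ 3 := by
      rw [← Real.rpow_natCast, ← Real.rpow_mul (by positivity), ← Real.rpow_natCast]
      norm_num
    rw [h5, div_pow, mul_pow, ← pow_mul, ← pow_mul, mul_comm k 2, mul_comm k 3, pow_mul, pow_mul,
      one_div_pow, one_div_pow, mul_one_div]
    norm_num
    gcongr
    norm_num
  calc _ ≤ (1353 * √3 * L * D' ^ 2 / ε * (512 / 32 ^ k)) ^ (2 / 3 : ℝ) :=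
        Real.rpow_le_rpow hX h1 (by norm_num)
    _ = (1353 * √3 * L * D' ^ 2 / ε) ^ (2 / 3 : ℝ) * (512 / 32 ^ k) ^ (2 / 3 : ℝ) :=
        Real.mul_rpow hY (by positivity)
    _ ≤ _ := mul_le_mul_of_nonneg_left h3 (Real.rpow_nonneg hY _)

theorem sum_Icc_eighth_pow_le (K : ℕ) : ∑ k ∈ Finset.Icc 1 K, (1 / 8 : ℝ) ^ k ≤ 1 / 7 := by
  suffices h : ∑ k ∈ Finset.Icc 1 K, (1 / 8 : ℝ) ^ k = 1 / 7 - 1 / 7 * (1 / 8) ^ K by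
    rw [h]
    have : (0 : ℝ) ≤ (1 / 8) ^ K := by positivity
    linarith
  induction K with
  | zero => simp
  | succ K ih =>
    rw [Finset.sum_Icc_succ_top (Nat.le_add_left 1 K), ih, pow_succ]
    ring

theorem IsFFCRRound.sum_count_le (h : IsFFCRRound f ε z0 M0 D K z zbar ztil H M N)
    (hf : ContDiff ℝ 2 (joint f))
    (hconv : ∀ y, ConvexOn ℝ Set.univ (fun x => f x y))
    (hconc : ∀ x, ConcaveOn ℝ Set.univ (fun y => f x y)) (hρ : 0 < ρ)
    (hLip : ∀ z z' : Pt m n, ‖fullHess f z - fullHess f z'‖ ≤ ρ * ‖z - z'‖)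
    (hε : 0 < ε) (hD : 0 < D) (hM0 : 0 < M0) {D' L : ℝ} (hDD : D ≤ D')
    (hL : L = max M0 (2 * ρ)) :
    ((∑ k ∈ Finset.Icc 1 K, N k : ℕ) : ℝ) ≤
      ((max 1 (outerCount ε D' ‖saddleJac f z0‖ L) : ℤ) : ℝ) +
        64 / 7 * (1353 * √3 * L * D' ^ 2 / ε) ^ (2 / 3 : ℝ) := by
  have hb := h.estimate_bounds hf hconv hconc hρ hLip hε hD hM0
  rw [← hL] at hb
  have hLpos : 0 < L := hL ▸ lt_max_of_lt_left hM0
  -- If K > 1, the exit test failed at K - 1, so K - 1 lies below a count that is monotone in D and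
  -- M. The exit test is not evaluated at 0, hence the maximum with 1.
  have hK : (K : ℤ) ≤ max 1 (outerCount ε D' ‖saddleJac f z0‖ L) := by
    rcases h.one_le.eq_or_lt with h1 | h1
    · rw [← h1]; simp
    · have h2 := h.go_on (K - 1) (by omega) (by omega)
      have h3 := hb (K - 1) (Nat.sub_le K 1)
      have h4 := outerCount_mono hε hD (hM0.trans_le h3.2.1) (norm_nonneg (saddleJac f z0)) hDD
        h3.2.2
      refine le_max_of_le_right ?_
      omega
  have hK' : (K : ℝ) ≤ ((max 1 (outerCount ε D' ‖saddleJac f z0‖ L) : ℤ) : ℝ) := by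
    exact_mod_cast hK
  have hY : 0 ≤ (1353 * √3 * L * D' ^ 2 / ε) ^ (2 / 3 : ℝ) :=
    Real.rpow_nonneg (by positivity) _
  have hsum : ∑ k ∈ Finset.Icc 1 K, (N k : ℝ) ≤ ∑ k ∈ Finset.Icc 1 K,
      (1 + (1353 * √3 * L * D' ^ 2 / ε) ^ (2 / 3 : ℝ) * (64 * (1 / 8) ^ k)) := by
    refine Finset.sum_le_sum fun k hk => ?_
    obtain ⟨hk1, hkK⟩ := Finset.mem_Icc.1 hk
    rw [h.count k hk1 hkK]
    exact innerCount_le hε hD (hM0.trans_le (hb k hkK).1.1) hk1 hDD (hb k hkK).1.2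
  rw [Finset.sum_add_distrib, ← Finset.mul_sum, ← Finset.mul_sum, Finset.sum_const, Nat.card_Icc,
    Nat.add_sub_cancel, nsmul_eq_mul, mul_one] at hsum
  rw [Nat.cast_sum]
  nlinarith [mul_le_mul_of_nonneg_left (sum_Icc_eighth_pow_le K) hY]

theorem IsFFCR.guess_eq {D0 : ℝ} {A : FFCRData m n} (hA : IsFFCR f ε z0 M0 D0 A) :
    ∀ t, A.Reached f ε t → A.D t = 4 ^ t * D0 := by
  intro t
  induction t with
  | zero => intro _; simp [hA.init_D]
  | succ t ih =>
    intro ht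
    rw [hA.next_D t ht, ih fun s hs => ht s (hs.trans (Nat.lt_succ_self t)), pow_succ]
    ring

end Complexity

/-! ### Quadrupling the guess: termination and total cost. -/

theorem theorem3p1 (m n : ℕ) (f : Obj m n)
    (hf : ContDiff ℝ 2 (joint f))
    (hconv : ∀ y, ConvexOn ℝ Set.univ (fun x => f x y))
    (hconc : ∀ x, ConcaveOn ℝ Set.univ (fun y => f x y))
    (ρ : ℝ) (hρ : 0 < ρ)
    (hLip : ∀ z z' : Pt m n, ‖fullHess f z - fullHess f z'‖ ≤ ρ * ‖z - z'‖)
    (zs : Pt m n) (hzs : IsSaddle f zs)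
    (ε : ℝ) (hε : 0 < ε) (z0 : Pt m n) (M0 D0 : ℝ) (hM0 : 0 < M0) (hD0 : 0 < D0)
    (A : FFCRData m n) (hA : IsFFCR f ε z0 M0 D0 A) :
    ∃ T : ℕ, IsLeast {t : ℕ | ‖fullGrad f (A.pt (t + 1))‖ ≤ ε} T ∧
      (∀ t ≤ T, A.D t ≤ max D0 (4 * ‖z0 - zs‖)) ∧
      (T : ℤ) ≤ max 0 ⌈Real.logb 4 (‖z0 - zs‖ / D0)⌉ ∧
      (∀ t ≤ T, ‖z0 - zs‖ ≤ A.D t → ‖fullGrad f (A.pt (t + 1))‖ ≤ ε) ∧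
      ∀ L Δ : ℝ, L = max M0 (2 * ρ) → Δ = max D0 (4 * ‖z0 - zs‖) →
        ((∑ t ∈ Finset.range (T + 1), ∑ k ∈ Finset.Icc 1 (A.K t), A.N t k : ℕ) : ℝ) ≤
          ((T : ℝ) + 1) *
            (((max 1 (outerCount ε Δ ‖saddleJac f z0‖ L) : ℤ) : ℝ) +
              64 / 7 * (1353 * √3 * L * Δ ^ 2 / ε) ^ (2 / 3 : ℝ)) := by
  have hDpos : ∀ t, A.Reached f ε t → 0 < A.D t := by
    intro t ht
    rw [hA.guess_eq t ht]
    positivity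
  have hgood : ∀ t, A.Reached f ε t → ‖z0 - zs‖ ≤ A.D t →
      ‖fullGrad f (A.pt (t + 1))‖ ≤ ε := by
    intro t ht hle
    rw [norm_fullGrad (hf.differentiable two_ne_zero), hA.output t ht]
    exact (hA.round t ht).norm_saddleOp_le hf hconv hconc hρ hLip hε (hDpos t ht) hM0 hzs hle
  have hex : ∃ t, ‖fullGrad f (A.pt (t + 1))‖ ≤ ε := by
    by_contra hcon
    have hreach : ∀ t, A.Reached f ε t := fun t s _ => not_le.1 fun hs => hcon ⟨s, hs⟩
    obtain ⟨t, ht⟩ := pow_unbounded_of_one_lt (‖z0 - zs‖ / D0) (by norm_num : (1 : ℝ) < 4)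
    refine hcon ⟨t, hgood t (hreach t) ?_⟩
    rw [hA.guess_eq t (hreach t)]
    exact ((div_lt_iff₀ hD0).1 ht).le
  classical
  have hreach : ∀ t ≤ Nat.find hex, A.Reached f ε t := fun t ht s hs =>
    not_le.1 (Nat.find_min hex (hs.trans_le ht))
  -- Every unsuccessful round had too small a guess; at t = T - 1 this yields both the bound on D_T
  -- and the bound on T.
  have hsmall : ∀ t < Nat.find hex, 4 ^ t * D0 < ‖z0 - zs‖ := by
    intro t ht
    rw [← hA.guess_eq t (hreach t ht.le)]
    exact not_le.1 fun hle => Nat.find_min hex ht (hgood t (hreach t ht.le) hle)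
  have hDle : ∀ t ≤ Nat.find hex, A.D t ≤ max D0 (4 * ‖z0 - zs‖) := by
    intro t ht
    rw [hA.guess_eq t (hreach t ht)]
    cases t with
    | zero => simp
    | succ t =>
      have := hsmall t ht
      refine le_max_of_le_right ?_
      rw [pow_succ]
      linarith
  refine ⟨Nat.find hex, ⟨Nat.find_spec hex, fun t ht => Nat.find_min' hex ht⟩, hDle, ?_,
    fun t ht => hgood t (hreach t ht), ?_⟩
  · rcases Nat.eq_zero_or_pos (Nat.find hex) with h0 | hpos
    · rw [h0]; simp
    · have h1 := hsmall (Nat.find hex - 1) (by omega)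
      have h2 : ((Nat.find hex - 1 : ℕ) : ℝ) < Real.logb 4 (‖z0 - zs‖ / D0) := by
        have h3 : (4 : ℝ) ^ (Nat.find hex - 1) < ‖z0 - zs‖ / D0 := (lt_div_iff₀ hD0).2 h1
        rw [Real.lt_logb_iff_rpow_lt (by norm_num) (lt_trans (by positivity) h3),
          Real.rpow_natCast]
        exact h3
      have h4 : ((Nat.find hex - 1 : ℕ) : ℤ) < ⌈Real.logb 4 (‖z0 - zs‖ / D0)⌉ :=
        Int.lt_ceil.2 (by exact_mod_cast h2)
      refine le_max_of_le_right ?_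
      omega
  · intro L Δ hL hΔ
    rw [Nat.cast_sum]
    have h1 := Finset.sum_le_card_nsmul (Finset.range (Nat.find hex + 1))
      (fun t => ((∑ k ∈ Finset.Icc 1 (A.K t), A.N t k : ℕ) : ℝ)) _ fun t ht => by
        have ht' : t ≤ Nat.find hex := Nat.lt_succ_iff.1 (Finset.mem_range.1 ht)
        exact (hA.round t (hreach t ht')).sum_count_le hf hconv hconc hρ hLip hε
          (hDpos t (hreach t ht')) hM0 ((hDle t ht').trans_eq hΔ.symm) hL
    rw [Finset.card_range, nsmul_eq_mul, Nat.cast_add_one] at h1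
    exact h1
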